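/- All spaces and algebras are real; algebras need not be unital; locally compact groups are Hausdorff. A cone in a vector space is a subset containing $0$ that is closed under addition and under multiplication by scalars $\ge 0$. A pre-ordered Banach algebra is a Banach algebra $E$ with a cone $E_+$ such that $E_+E_+\subseteq E_+$. For a pre-ordered normed space $X$, $B(X)_+=\{T\in B(X): TX_+\subseteq X_+\}$. A bounded approximate left (right) identity is positive if it is a net in the cone. $\mathcal M_l(E)\subseteq B(E)$ is the algebra of bounded operators $L$ with $L(ab)=(La)b$ for all $a,b$, with cone $\mathcal M_l(E)_+=\mathcal M_l(E)\cap B(E)_+$, and $\lambda:E\to\mathcal M_l(E)$, $\lambda(a)b=ab$. A representation $\pi$ of an algebra on $X$ is non-degenerate if the linear span of $\{\pi(a)x\}$ is dense in $X$, and positive if it maps positive elements into $B(X)_+$. Let $A$ be a pre-ordered Banach algebra with closed cone $A_+$, having both a positive bounded approximate left identity and a positive bounded approximate right identity. Let $G$ be a locally compact group with a left Haar measure, and let $\alpha$ be a strongly continuous action of $G$ on $A$ by bounded automorphisms with $\alpha_s(A_+)\subseteq A_+$ for all $s\in G$. A continuous covariant representation of $(A,G,\alpha)$ on a Banach space $X$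 is a pair $(\pi,U)$ of a bounded homomorphism $\pi:A\to B(X)$ and a strongly continuous homomorphism $U$ from $G$ to the invertible elements of $B(X)$ with $\pi(\alpha_s(a))=U_s\pi(a)U_s^{-1}$; it is non-degenerate if $\pi$ is, and positive if $\pi$ is positive and all $U_s$ are positive. Its integrated form is $(\pi\rtimes U)(f)x=\int_G\pi(f(r))U_rx\,dr$ for $f\in C_c(G,A)$. On $C_c(G,A)$ use the product $(f*g)(s)=\int_G f(r)\alpha_r(g(r^{-1}s))\,dr$. Let $\mathcal R$ be a non-empty class of positive non-degenerate continuous covariant representations of $(A,G,\alpha)$ on pre-ordered Banach spaces with closed cones that is uniformly bounded: there are $C\ge0$ and $\nu:G\to[0,\infty)$, bounded on compact sets, with $\|\pi\|\le C$ and $\|U_r\|\le\nu(r)$ for all $(\pi,U)\in\mathcal R$ and $r\in G$. Put $\sigma^{\mathcal R}(f)=\sup_{(\pi,U)\in\mathcal R}\|(\pi\rtimes U)(f)\|$. A continuous covariant representation $(\pi,U)$ is $\mathcal R$-continuous if $\|(\pi\rtimes U)(f)\|\le M\sigma^{\mathcal R}(f)$ for some $M$ and all $f\in C_c(G,A)$.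 Let $(A\rtimes_\alpha G)^{\mathcal R}$ be the completion of $C_c(G,A)/\ker\sigma^{\mathcal R}$ in the norm induced by $\sigma^{\mathcal R}$, let $q^{\mathcal R}$ be the canonical map from $C_c(G,A)$ to it, let its cone be the closure of $q^{\mathcal R}(C_c(G,A_+))$, and let $i_A^{\mathcal R}(a)$, $i_G^{\mathcal R}(r)$ be the bounded operators on it with $i_A^{\mathcal R}(a)q^{\mathcal R}(f)=q^{\mathcal R}(s\mapsto af(s))$ and $i_G^{\mathcal R}(r)q^{\mathcal R}(f)=q^{\mathcal R}(s\mapsto\alpha_r(f(r^{-1}s)))$. Call $(E,k_A,k_G)$ a generating triple if $E$ is a pre-ordered Banach algebra with closed cone and a positive bounded approximate left identity, $\lambda:E\to\mathcal M_l(E)$ is a topological embedding with $\lambda(b)\in\mathcal M_l(E)_+$ if and only if $b\in E_+$, and $(k_A,k_G)$ is a positive non-degenerate $\mathcal R$-continuous covariant representation of $(A,G,\alpha)$ on the pre-ordered Banach space $E$ such that: 1. $k_A(A),k_G(G)\subseteq\mathcal M_l(E)$; 2. $(k_A\rtimes k_G)(C_c(G,A))\subseteq\lambda(E)$; 3. $(k_A\rtimes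 k_G)(C_c(G,A))$ is dense in $\lambda(E)$; 4. $(k_A\rtimes k_G)(C_c(G,A_+))$ is dense in $\lambda(E)\cap\mathcal M_l(E)_+$; 5. for every positive non-degenerate $\mathcal R$-continuous covariant representation $(\pi,U)$ of $(A,G,\alpha)$ on a pre-ordered Banach space $X$ with closed cone there are positive non-degenerate bounded representations $T:E\to B(X)$ and $\overline T:\mathcal M_l(E)\to B(X)$ with $\overline T\circ\lambda=T$, $\overline T\circ k_A=\pi$ and $\overline T\circ k_G=U$. Then $((A\rtimes_\alpha G)^{\mathcal R},i_A^{\mathcal R},i_G^{\mathcal R})$ is a generating triple. Moreover, for every generating triple $(E,k_A,k_G)$ there is a unique topological algebra isomorphism $\psi:(A\rtimes_\alpha G)^{\mathcal R}\to E$ such that $k_A(a)=\psi\, i_A^{\mathcal R}(a)\,\psi^{-1}$ for all $a\in A$ and $k_G(s)=\psi\, i_G^{\mathcal R}(s)\,\psi^{-1}$ for all $s\in G$; this $\psi$ is bipositive (that is, $\psi(x)\in E_+$ if and only if $x$ is in the cone of $(A\rtimes_\alpha G)^{\mathcal R}$), and $E$ has a positive bounded approximate right identity. -/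

import Mathlib

open MeasureTheory Filter Topology
open scoped CompactlySupported

universe u v w

set_option linter.unusedSectionVars false

noncomputable section

namespace OrderedCrossedProduct

/-! ### Pre-ordered Banach algebra dynamical systems and covariant representations

A cone (a subset closed under addition and under multiplication by non-negative scalars) is a
`PointedCone ℝ V`. All spaces and algebras are real; algebras need not be unital. -/

/-- The positive operators on a pre-ordered normed space: those mapping the cone into itself. -/
def positiveOperators {X : Type v} [NormedAddCommGroup X] [NormedSpace ℝ X]
    (C : PointedCone ℝ X) : Set (X →L[ℝ] X) :=
  {T | ∀ x ∈ C, T x ∈ C}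

/-- The cone `C` makes the algebra `E` a pre-ordered algebra. -/
def IsAlgebraCone {E : Type v} [NonUnitalNormedRing E] [NormedSpace ℝ E]
    (C : PointedCone ℝ E) : Prop :=
  ∀ a ∈ C, ∀ b ∈ C, a * b ∈ C

/-- A net in `C`, bounded in norm, that is an approximate left identity of `E`. -/
def HasPosBddApproxLeftIdentity {E : Type u} [NonUnitalNormedRing E] [NormedSpace ℝ E]
    (C : PointedCone ℝ E) : Prop :=
  ∃ (ι : Type u) (_ : Preorder ι) (_ : IsDirectedOrder ι) (_ : Nonempty ι) (e : ι → E) (M : ℝ),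
    (∀ i, e i ∈ C) ∧ (∀ i, ‖e i‖ ≤ M) ∧ ∀ a : E, Tendsto (fun i => e i * a) atTop (𝓝 a)

/-- A net in `C`, bounded in norm, that is an approximate right identity of `E`. -/
def HasPosBddApproxRightIdentity {E : Type u} [NonUnitalNormedRing E] [NormedSpace ℝ E]
    (C : PointedCone ℝ E) : Prop :=
  ∃ (ι : Type u) (_ : Preorder ι) (_ : IsDirectedOrder ι) (_ : Nonempty ι) (e : ι → E) (M : ℝ),
    (∀ i, e i ∈ C) ∧ (∀ i, ‖e i‖ ≤ M) ∧ ∀ a : E, Tendsto (fun i => a * e i) atTop (𝓝 a)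

/-- A pre-ordered Banach algebra dynamical system `(A, G, α)`: the algebra `A` carries a closed
cone, and `α` is a strongly continuous action of `G` by bounded bipositive automorphisms
(positivity of the inverse of `α s` is positivity of `α s⁻¹`). -/
structure DynSystem (A G : Type u) [NonUnitalNormedRing A] [NormedSpace ℝ A]
    [Group G] [TopologicalSpace G] where
  cone : PointedCone ℝ A
  isAlgebraCone : IsAlgebraCone cone
  isClosed_cone : IsClosed (cone : Set A)
  α : G →* (A ≃L[ℝ] A)
  α_mul : ∀ s a b, α s (a * b) = α s a * α s b
  α_mem_cone : ∀ s, ∀ a ∈ cone, α s a ∈ cone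
  continuous_α : ∀ a, Continuous fun s => α s a

variable {A G : Type u} [NonUnitalNormedRing A] [NormedSpace ℝ A]
  [Group G] [TopologicalSpace G]

/-- `(π, U)` is a continuous covariant representation of `(A, G, α)` on `X`: `π` is an algebra
homomorphism that is bounded, and `U` is a strongly continuous representation of `G` by invertible
operators (a monoid homomorphism out of a group takes invertible values) with
`π (α s a) = U s ∘ π a ∘ (U s)⁻¹`. -/
structure IsContCovRep (D : DynSystem A G) {X : Type v} [NormedAddCommGroup X] [NormedSpace ℝ X]
    (π : A →ₙₐ[ℝ] (X →L[ℝ] X)) (U : G →* (X →L[ℝ] X)) : Prop where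
  covariant : ∀ s a, π (D.α s a) = U s * π a * U s⁻¹
  bounded : ∃ C : ℝ, ∀ a, ‖π a‖ ≤ C * ‖a‖
  strongly_continuous : ∀ x, Continuous fun s => U s x

/-- Non-degeneracy of a representation `π` of an algebra `B` on `X`: the linear span of
`{π b x}` is dense. -/
def IsNondegenerate {B : Type w} {X : Type v} [NormedAddCommGroup X] [NormedSpace ℝ X]
    (π : B → X →L[ℝ] X) : Prop :=
  Dense (Submodule.span ℝ {y : X | ∃ b x, y = π b x} : Set X)

/-- Positivity of a covariant representation on a space with cone `C`; as `U` is defined on a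
group, all `U s` are then bipositive. -/
def IsPositiveCovRep (D : DynSystem A G) {X : Type v} [NormedAddCommGroup X] [NormedSpace ℝ X]
    (C : PointedCone ℝ X) (π : A →ₙₐ[ℝ] (X →L[ℝ] X)) (U : G →* (X →L[ℝ] X)) : Prop :=
  (∀ a ∈ D.cone, π a ∈ positiveOperators C) ∧ ∀ s, U s ∈ positiveOperators C

/-! ### Auxiliary facts on strongly continuous families of operators -/

section aux

variable {X : Type v} [NormedAddCommGroup X] [NormedSpace ℝ X] [CompleteSpace X]

theorem exists_norm_le_of_isCompact {V : G → X →L[ℝ] X} (hV : ∀ x, Continuous fun s => V s x)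
    {K : Set G} (hK : IsCompact K) : ∃ M : ℝ, 0 ≤ M ∧ ∀ s ∈ K, ‖V s‖ ≤ M := by
  obtain ⟨M, hM⟩ := banach_steinhaus (g := fun s : K => V s) (fun x => by
    obtain ⟨C, hC⟩ := hK.bddAbove_image (f := fun s => ‖V s x‖) (hV x).norm.continuousOn
    exact ⟨C, fun i => hC ⟨i, i.2, rfl⟩⟩)
  exact ⟨max M 0, le_max_right _ _, fun s hs => (hM ⟨s, hs⟩).trans (le_max_left _ _)⟩

theorem continuous_apply_of_strong [LocallyCompactSpace G] {V : G → X →L[ℝ] X}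
    (hV : ∀ x, Continuous fun s => V s x) {Z : Type w} [TopologicalSpace Z] {p : Z → G} {x : Z → X}
    (hp : Continuous p) (hx : Continuous x) : Continuous fun z => V (p z) (x z) := by
  rw [continuous_iff_continuousAt]
  intro z₀
  obtain ⟨K, hK, hKn⟩ := exists_compact_mem_nhds (p z₀)
  obtain ⟨M, hM0, hM⟩ := exists_norm_le_of_isCompact hV hK
  have h1 : Tendsto (fun z => V (p z) (x z₀)) (𝓝 z₀) (𝓝 (V (p z₀) (x z₀))) :=
    ((hV (x z₀)).comp hp).tendsto z₀
  have h2 : Tendsto (fun z => V (p z) (x z - x z₀)) (𝓝 z₀) (𝓝 0) := by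
    have h3 : Tendsto (fun z => M * ‖x z - x z₀‖) (𝓝 z₀) (𝓝 0) := by
      have : Continuous fun z => M * ‖x z - x z₀‖ := by fun_prop
      simpa using this.tendsto z₀
    refine squeeze_zero_norm' ?_ h3
    filter_upwards [hp.continuousAt.preimage_mem_nhds hKn] with z hz
    exact (V (p z)).le_of_opNorm_le (hM _ hz) _
  have := h1.add h2
  simpa [ContinuousAt] using this

end aux

theorem DynSystem.continuous_α_apply [CompleteSpace A] [LocallyCompactSpace G] (D : DynSystem A G)
    {Z : Type w} [TopologicalSpace Z] {p : Z → G} {x : Z → A}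
    (hp : Continuous p) (hx : Continuous x) : Continuous fun z => D.α (p z) (x z) :=
  continuous_apply_of_strong (V := fun s => (D.α s : A →L[ℝ] A)) D.continuous_α hp hx

/-! ### Twisted convolution and integrated forms -/

section conv

variable [IsScalarTower ℝ A A] [SMulCommClass ℝ A A] [CompleteSpace A] [IsTopologicalGroup G]
  [LocallyCompactSpace G] [T2Space G] [MeasurableSpace G] [BorelSpace G]

/-- The set `supp f * supp g`, which carries `f * g`. -/
def convSupport (f g : C_c(G, A)) : Set G :=
  (fun p : G × G => p.1 * p.2) '' (tsupport f ×ˢ tsupport g)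

theorem isCompact_convSupport (f g : C_c(G, A)) : IsCompact (convSupport f g) :=
  (f.hasCompactSupport.isCompact.prod g.hasCompactSupport.isCompact).image (by fun_prop)

theorem continuous_conv_integrand (D : DynSystem A G) (f g : C_c(G, A)) :
    Continuous fun p : G × G => f p.1 * D.α p.1 (g (p.1⁻¹ * p.2)) := by
  have h := D.continuous_α_apply (Z := G × G) (p := fun p => p.1)
    (x := fun p => g (p.1⁻¹ * p.2)) (by fun_prop) (by fun_prop)
  have : Continuous fun p : G × G => f p.1 := by fun_prop
  exact this.mul h

theorem conv_integrand_eq_zero (D : DynSystem A G) (f g : C_c(G, A)) (p : G × G)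
    (hp : p ∉ (tsupport f) ×ˢ (convSupport f g)) :
    f p.1 * D.α p.1 (g (p.1⁻¹ * p.2)) = 0 := by
  by_cases h1 : p.1 ∈ tsupport f
  · by_cases h2 : p.1⁻¹ * p.2 ∈ tsupport g
    · have h3 : p.2 ∈ convSupport f g := ⟨(p.1, p.1⁻¹ * p.2), ⟨h1, h2⟩, by simp⟩
      exact absurd (Set.mk_mem_prod h1 h3) hp
    · simp [image_eq_zero_of_notMem_tsupport h2]
  · simp [image_eq_zero_of_notMem_tsupport h1]

/-- The twisted convolution `(f * g)(s) = ∫ f(r) α_r(g(r⁻¹ s)) dr`. -/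
def conv (D : DynSystem A G) (μ : Measure G) [μ.IsHaarMeasure] (f g : C_c(G, A)) : C_c(G, A) where
  toFun s := ∫ r, f r * D.α r (g (r⁻¹ * s)) ∂μ
  continuous_toFun := by
    have := continuousOn_integral_of_compact_support (μ := μ)
      (f := fun s r => f r * D.α r (g (r⁻¹ * s))) (s := Set.univ)
      (k := tsupport f) f.hasCompactSupport
      ((continuous_conv_integrand D f g).comp continuous_swap).continuousOn
      (fun p x _ hx => by simp [image_eq_zero_of_notMem_tsupport hx])
    exact continuousOn_univ.mp this
  hasCompactSupport' := by
    refine HasCompactSupport.intro (isCompact_convSupport f g) fun s hs => ?_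
    refine integral_eq_zero_of_ae (Eventually.of_forall fun r => ?_)
    exact conv_integrand_eq_zero D f g (r, s) fun h => hs h.2

theorem conv_apply (D : DynSystem A G) (μ : Measure G) [μ.IsHaarMeasure] (f g : C_c(G, A)) (s : G) :
    conv D μ f g s = ∫ r, f r * D.α r (g (r⁻¹ * s)) ∂μ := rfl

theorem integrable_conv (D : DynSystem A G) (μ : Measure G) [μ.IsHaarMeasure]
    (f g : C_c(G, A)) (s : G) : Integrable (fun r => f r * D.α r (g (r⁻¹ * s))) μ := by
  refine Continuous.integrable_of_hasCompactSupport ?_ ?_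
  · exact (continuous_conv_integrand D f g).comp (Continuous.prodMk_left s)
  · exact HasCompactSupport.intro f.hasCompactSupport fun r hr => by
      simp [image_eq_zero_of_notMem_tsupport hr]

/-- Fubini and left invariance, in the form used for associativity and multiplicativity. -/
theorem integral_conv (D : DynSystem A G) (μ : Measure G) [μ.IsHaarMeasure] (f g : C_c(G, A))
    {W : Type v} {W' : Type w} [NormedAddCommGroup W] [NormedSpace ℝ W] [CompleteSpace W]
    [NormedAddCommGroup W'] [NormedSpace ℝ W'] (Ψ : A →L[ℝ] W' →L[ℝ] W) {y : G → W'}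
    (hy : Continuous y) :
    ∫ s, Ψ (conv D μ f g s) (y s) ∂μ
      = ∫ r, ∫ s, Ψ (f r * D.α r (g s)) (y (r * s)) ∂μ ∂μ := by
  have h1 : ∀ s, Ψ (conv D μ f g s) (y s)
      = ∫ r, Ψ (f r * D.α r (g (r⁻¹ * s))) (y s) ∂μ := fun s => by
    rw [conv_apply]
    exact ((Ψ.flip (y s)).integral_comp_comm (integrable_conv D μ f g s)).symm
  simp_rw [h1]
  rw [integral_integral_swap_of_hasCompactSupport]
  · refine integral_congr_ae (Eventually.of_forall fun r => ?_)
    have := integral_mul_left_eq_self (μ := μ)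
      (fun s => Ψ (f r * D.α r (g s)) (y (r * s))) r⁻¹
    simpa using this
  · have h2 : Continuous fun p : G × G => f p.2 * D.α p.2 (g (p.2⁻¹ * p.1)) :=
      (continuous_conv_integrand D f g).comp continuous_swap
    have h3 : Continuous fun p : G × G => y p.1 := by fun_prop
    exact (Ψ.continuous.comp h2).clm_apply h3
  · refine HasCompactSupport.intro
      ((isCompact_convSupport f g).prod f.hasCompactSupport.isCompact) fun p hp => ?_
    have := conv_integrand_eq_zero D f g p.swap (fun h => hp ⟨h.2, h.1⟩)
    simp only [Prod.fst_swap, Prod.snd_swap] at this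
    simp [Function.uncurry, this]

theorem conv_assoc (D : DynSystem A G) (μ : Measure G) [μ.IsHaarMeasure] (f g h : C_c(G, A)) :
    conv D μ (conv D μ f g) h = conv D μ f (conv D μ g h) := by
  ext s
  rw [conv_apply]
  have := integral_conv D μ f g (ContinuousLinearMap.mul ℝ A) (y := fun r => D.α r (h (r⁻¹ * s)))
    (D.continuous_α_apply continuous_id (by fun_prop))
  simp only [ContinuousLinearMap.mul_apply'] at this
  rw [this, conv_apply]
  refine integral_congr_ae (Eventually.of_forall fun r => ?_)
  simp only
  rw [conv_apply]
  have e : f r * D.α r (∫ t, g t * D.α t (h (t⁻¹ * (r⁻¹ * s))) ∂μ)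
      = ∫ t, f r * D.α r (g t * D.α t (h (t⁻¹ * (r⁻¹ * s)))) ∂μ :=
    ((ContinuousLinearMap.mul ℝ A (f r)).comp
      (D.α r : A →L[ℝ] A)).integral_comp_comm (integrable_conv D μ g h (r⁻¹ * s)) |>.symm
  rw [e]
  refine integral_congr_ae (Eventually.of_forall fun t => ?_)
  simp only [map_mul, D.α_mul, mul_assoc, mul_inv_rev]
  rfl

theorem conv_add (D : DynSystem A G) (μ : Measure G) [μ.IsHaarMeasure] (f g h : C_c(G, A)) :
    conv D μ f (g + h) = conv D μ f g + conv D μ f h := by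
  ext s
  simp only [conv_apply, CompactlySupportedContinuousMap.add_apply]
  rw [← integral_add (integrable_conv D μ f g s) (integrable_conv D μ f h s)]
  simp [mul_add]

theorem add_conv (D : DynSystem A G) (μ : Measure G) [μ.IsHaarMeasure] (f g h : C_c(G, A)) :
    conv D μ (f + g) h = conv D μ f h + conv D μ g h := by
  ext s
  simp only [conv_apply, CompactlySupportedContinuousMap.add_apply]
  rw [← integral_add (integrable_conv D μ f h s) (integrable_conv D μ g h s)]
  simp [add_mul]

theorem conv_smul (D : DynSystem A G) (μ : Measure G) [μ.IsHaarMeasure] (c : ℝ) (f g : C_c(G, A)) :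
    conv D μ f (c • g) = c • conv D μ f g := by
  ext s
  simp only [conv_apply, CompactlySupportedContinuousMap.smul_apply]
  rw [← integral_smul]
  simp [mul_smul_comm]

theorem smul_conv (D : DynSystem A G) (μ : Measure G) [μ.IsHaarMeasure] (c : ℝ) (f g : C_c(G, A)) :
    conv D μ (c • f) g = c • conv D μ f g := by
  ext s
  simp only [conv_apply, CompactlySupportedContinuousMap.smul_apply]
  rw [← integral_smul]
  simp [smul_mul_assoc]

/-! The integrated form of a continuous covariant representation. -/

section integrated

variable {D : DynSystem A G} {X : Type v} [NormedAddCommGroup X] [NormedSpace ℝ X]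
  {π : A →ₙₐ[ℝ] (X →L[ℝ] X)} {U : G →* (X →L[ℝ] X)}

/-- The bounded homomorphism `π` as a bounded linear map. -/
def IsContCovRep.πL (h : IsContCovRep D π U) : A →L[ℝ] X →L[ℝ] X :=
  { toLinearMap := (π : A →ₗ[ℝ] (X →L[ℝ] X))
    cont := by
      obtain ⟨C, hC⟩ := h.bounded
      exact AddMonoidHomClass.continuous_of_bound (π : A →ₗ[ℝ] (X →L[ℝ] X)) C hC }

@[simp] theorem IsContCovRep.πL_apply (h : IsContCovRep D π U) (a : A) : h.πL a = π a := rfl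

theorem IsContCovRep.continuous_integrand (h : IsContCovRep D π U) (f : C_c(G, A)) (x : X) :
    Continuous fun r => π (f r) (U r x) := by
  have h1 : Continuous fun r => h.πL (f r) := h.πL.continuous.comp (by fun_prop)
  exact h1.clm_apply (h.strongly_continuous x)

theorem IsContCovRep.integrable (h : IsContCovRep D π U) (μ : Measure G) [μ.IsHaarMeasure]
    (f : C_c(G, A)) (x : X) : Integrable (fun r => π (f r) (U r x)) μ := by
  refine (h.continuous_integrand f x).integrable_of_hasCompactSupport ?_
  exact HasCompactSupport.intro f.hasCompactSupport fun r hr => by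
      simp [image_eq_zero_of_notMem_tsupport hr]

variable [CompleteSpace X]

theorem IsContCovRep.norm_integral_le (_h : IsContCovRep D π U) (μ : Measure G) [μ.IsHaarMeasure]
    (f : C_c(G, A)) {C M : ℝ} (hC0 : 0 ≤ C) (hC : ∀ a, ‖π a‖ ≤ C * ‖a‖)
    (hM : ∀ r ∈ tsupport f, ‖U r‖ ≤ M) (x : X) :
    ‖∫ r, π (f r) (U r x) ∂μ‖ ≤ (C * M * ∫ r, ‖f r‖ ∂μ) * ‖x‖ := by
  have hf : Integrable (fun r => ‖f r‖) μ :=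
    (f.continuous.integrable_of_hasCompactSupport f.hasCompactSupport).norm
  have : ‖∫ r, π (f r) (U r x) ∂μ‖ ≤ ∫ r, (C * M * ‖x‖) * ‖f r‖ ∂μ := by
    refine norm_integral_le_of_norm_le (hf.const_mul _) (Eventually.of_forall fun r => ?_)
    by_cases hr : r ∈ tsupport f
    · calc ‖π (f r) (U r x)‖ ≤ ‖π (f r)‖ * (‖U r‖ * ‖x‖) :=
            (π (f r)).le_opNorm_of_le ((U r).le_opNorm x)
        _ ≤ (C * ‖f r‖) * (M * ‖x‖) := by
            gcongr
            · exact hC _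
            · exact hM r hr
        _ = _ := by ring
    · simp [image_eq_zero_of_notMem_tsupport hr]
  refine this.trans_eq ?_
  rw [integral_const_mul]
  ring

/-- The integrated form `(π ⋊ U)(f) x = ∫ π(f(r)) U_r x dr`. -/
def IsContCovRep.integrated (h : IsContCovRep D π U) (μ : Measure G) [μ.IsHaarMeasure]
    (f : C_c(G, A)) : X →L[ℝ] X :=
  { toFun x := ∫ r, π (f r) (U r x) ∂μ
    map_add' x y := by
      rw [← integral_add (h.integrable μ f x) (h.integrable μ f y)]
      simp
    map_smul' c x := by
      rw [RingHom.id_apply, ← integral_smul]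
      simp
    cont := by
      obtain ⟨C, hC⟩ := h.bounded
      obtain ⟨M, -, hM⟩ := exists_norm_le_of_isCompact (V := U) h.strongly_continuous
        f.hasCompactSupport.isCompact
      have hC' : ∀ a, ‖π a‖ ≤ max C 0 * ‖a‖ := fun a => (hC a).trans (by gcongr; simp)
      exact AddMonoidHomClass.continuous_of_bound
        ({ toFun x := ∫ r, π (f r) (U r x) ∂μ
           map_zero' := by simp
           map_add' x y := by
              rw [← integral_add (h.integrable μ f x) (h.integrable μ f y)]
              simp } : X →+ X) _ (h.norm_integral_le μ f (le_max_right C 0) hC' hM) }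

theorem IsContCovRep.integrated_apply (h : IsContCovRep D π U) (μ : Measure G) [μ.IsHaarMeasure]
    (f : C_c(G, A)) (x : X) : h.integrated μ f x = ∫ r, π (f r) (U r x) ∂μ := rfl

theorem IsContCovRep.integrated_add (h : IsContCovRep D π U) (μ : Measure G) [μ.IsHaarMeasure]
    (f g : C_c(G, A)) : h.integrated μ (f + g) = h.integrated μ f + h.integrated μ g := by
  ext x
  change _ = h.integrated μ f x + h.integrated μ g x
  simp only [integrated_apply]
  rw [← integral_add (h.integrable μ f x) (h.integrable μ g x)]
  simp

theorem IsContCovRep.integrated_smul (h : IsContCovRep D π U) (μ : Measure G) [μ.IsHaarMeasure]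
    (c : ℝ) (f : C_c(G, A)) : h.integrated μ (c • f) = c • h.integrated μ f := by
  ext x
  change _ = c • h.integrated μ f x
  simp only [integrated_apply]
  rw [← integral_smul]
  simp

theorem IsContCovRep.integrated_conv (h : IsContCovRep D π U) (μ : Measure G) [μ.IsHaarMeasure]
    (f g : C_c(G, A)) :
    h.integrated μ (conv D μ f g) = h.integrated μ f * h.integrated μ g := by
  ext x
  change _ = h.integrated μ f (h.integrated μ g x)
  rw [integrated_apply, integrated_apply, integrated_apply]
  have := integral_conv D μ f g h.πL (y := fun s => U s x) (h.strongly_continuous x)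
  simp only [h.πL_apply] at this
  rw [this]
  refine integral_congr_ae (Eventually.of_forall fun r => ?_)
  have e : π (f r) (U r (∫ s, π (g s) (U s x) ∂μ)) = ∫ s, π (f r) (U r (π (g s) (U s x))) ∂μ :=
    ((π (f r)).comp (U r)).integral_comp_comm (h.integrable μ g x) |>.symm
  simp only
  rw [e]
  refine integral_congr_ae (Eventually.of_forall fun s => ?_)
  have hinv : U r⁻¹ (U r (U s x)) = U s x := by
    change (U r⁻¹ * U r) (U s x) = U s x
    rw [← map_mul]; simp
  simp [map_mul, h.covariant, hinv]

end integrated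

/-! ### Uniformly bounded classes of representations and the induced seminorm -/

/-- A continuous covariant representation of `(A, G, α)` on some pre-ordered Banach space with a
closed cone. Positivity of the representation is not part of this structure. -/
structure PreorderedRep (D : DynSystem A G) : Type (u + 1) where
  X : Type u
  [normedAddCommGroup : NormedAddCommGroup X]
  [normedSpace : NormedSpace ℝ X]
  [completeSpace : CompleteSpace X]
  cone : PointedCone ℝ X
  isClosed_cone : IsClosed (cone : Set X)
  π : A →ₙₐ[ℝ] (X →L[ℝ] X)
  U : G →* (X →L[ℝ] X)
  isContCovRep : IsContCovRep D π U

attribute [instance] PreorderedRep.normedAddCommGroup PreorderedRep.normedSpace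
  PreorderedRep.completeSpace

/-- A (non-empty) uniformly bounded class of continuous covariant representations: `‖π‖ ≤ C` and
`‖U r‖ ≤ ν r` throughout, with `ν` bounded on compact sets. -/
structure UniformlyBoundedClass (D : DynSystem A G) : Type (u + 1) where
  carrier : Set (PreorderedRep D)
  nonempty : carrier.Nonempty
  bounded : ∃ (C : ℝ) (ν : G → ℝ), 0 ≤ C ∧ (∀ r, 0 ≤ ν r) ∧
    (∀ K : Set G, IsCompact K → BddAbove (ν '' K)) ∧
    ∀ ρ ∈ carrier, (∀ a, ‖ρ.π a‖ ≤ C * ‖a‖) ∧ ∀ r, ‖ρ.U r‖ ≤ ν r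

section seminorm

variable {D : DynSystem A G} (μ : Measure G) [μ.IsHaarMeasure] (R : UniformlyBoundedClass D)

/-- `σ^R(f)`, the supremum of `‖(π ⋊ U)(f)‖` over `(π, U) ∈ R`. -/
def sigma (f : C_c(G, A)) : ℝ := ⨆ ρ : R.carrier, ‖ρ.1.isContCovRep.integrated μ f‖

theorem bddAbove_sigma (f : C_c(G, A)) :
    BddAbove (Set.range fun ρ : R.carrier => ‖ρ.1.isContCovRep.integrated μ f‖) := by
  obtain ⟨C, ν, hC, hν, hνK, h⟩ := R.bounded
  obtain ⟨M, hM⟩ := hνK (tsupport f) f.hasCompactSupport.isCompact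
  refine ⟨C * max M 0 * ∫ r, ‖f r‖ ∂μ, ?_⟩
  rintro _ ⟨ρ, rfl⟩
  refine ContinuousLinearMap.opNorm_le_bound _ ?_ fun x => ?_
  · have : 0 ≤ ∫ r, ‖f r‖ ∂μ := integral_nonneg fun r => norm_nonneg _
    positivity
  · exact ρ.1.isContCovRep.norm_integral_le μ f hC (h ρ.1 ρ.2).1 (fun r hr =>
      ((h ρ.1 ρ.2).2 r).trans ((hM ⟨r, hr, rfl⟩).trans (le_max_left _ _))) x

theorem norm_integrated_le_sigma {ρ : PreorderedRep D} (hρ : ρ ∈ R.carrier) (f : C_c(G, A)) :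
    ‖ρ.isContCovRep.integrated μ f‖ ≤ sigma μ R f :=
  le_ciSup (bddAbove_sigma μ R f) (⟨ρ, hρ⟩ : R.carrier)

theorem sigma_le {f : C_c(G, A)} {M : ℝ}
    (h : ∀ ρ ∈ R.carrier, ‖ρ.isContCovRep.integrated μ f‖ ≤ M) : sigma μ R f ≤ M :=
  haveI : Nonempty R.carrier := R.nonempty.to_subtype
  ciSup_le fun ρ => h ρ.1 ρ.2

theorem sigma_nonneg (f : C_c(G, A)) : 0 ≤ sigma μ R f :=
  Real.iSup_nonneg fun _ => norm_nonneg _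

theorem sigma_add (f g : C_c(G, A)) : sigma μ R (f + g) ≤ sigma μ R f + sigma μ R g :=
  sigma_le μ R fun ρ hρ => by
    rw [ρ.isContCovRep.integrated_add]
    exact (norm_add_le _ _).trans
      (add_le_add (norm_integrated_le_sigma μ R hρ f) (norm_integrated_le_sigma μ R hρ g))

theorem sigma_smul (c : ℝ) (f : C_c(G, A)) : sigma μ R (c • f) ≤ ‖c‖ * sigma μ R f :=
  sigma_le μ R fun ρ hρ => by
    rw [ρ.isContCovRep.integrated_smul, norm_smul]
    exact mul_le_mul_of_nonneg_left (norm_integrated_le_sigma μ R hρ f) (norm_nonneg _)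

theorem sigma_conv (f g : C_c(G, A)) : sigma μ R (conv D μ f g) ≤ sigma μ R f * sigma μ R g :=
  sigma_le μ R fun ρ hρ => by
    rw [ρ.isContCovRep.integrated_conv]
    exact (norm_mul_le _ _).trans (mul_le_mul (norm_integrated_le_sigma μ R hρ f)
      (norm_integrated_le_sigma μ R hρ g) (norm_nonneg _) (sigma_nonneg μ R f))

/-! ### The crossed product -/

/-- `C_c(G, A)` as an algebra under twisted convolution with the algebra seminorm `σ^R`. -/
def CcAlg (_μ : Measure G) [_μ.IsHaarMeasure] (_R : UniformlyBoundedClass D) : Type u := C_c(G, A)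

/-- A function in `C_c(G, A)`, as an element of the seminormed algebra. -/
def toCcAlg (f : C_c(G, A)) : CcAlg μ R := f

instance : AddCommGroup (CcAlg μ R) := inferInstanceAs (AddCommGroup C_c(G, A))

instance : Module ℝ (CcAlg μ R) := inferInstanceAs (Module ℝ C_c(G, A))

instance : NonUnitalRing (CcAlg μ R) where
  mul f g := conv D μ f g
  left_distrib f g h := conv_add D μ f g h
  right_distrib f g h := add_conv D μ f g h
  zero_mul f := by
    have := smul_conv D μ 0 (0 : C_c(G, A)) f
    rwa [zero_smul, zero_smul] at this
  mul_zero f := by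
    have := conv_smul D μ 0 f (0 : C_c(G, A))
    rwa [zero_smul, zero_smul] at this
  mul_assoc f g h := conv_assoc D μ f g h

instance : SeminormedAddCommGroup (CcAlg μ R) :=
  AddGroupSeminorm.toSeminormedAddCommGroup
    { toFun := fun f => sigma μ R f
      map_zero' := le_antisymm
        (by have := sigma_smul μ R 0 (0 : C_c(G, A)); rwa [zero_smul, norm_zero, zero_mul] at this)
        (sigma_nonneg μ R _)
      add_le' := sigma_add μ R
      neg' := fun f => by
        have h : ∀ f : C_c(G, A), sigma μ R (-f) ≤ sigma μ R f := fun f => by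
          have := sigma_smul μ R (-1) f
          simpa using this
        have h2 : ∀ f : C_c(G, A), sigma μ R f ≤ sigma μ R (-f) := fun f => by
          have := h (-f)
          rwa [neg_neg] at this
        exact le_antisymm (h f) (h2 f) }

instance : NormedSpace ℝ (CcAlg μ R) where
  norm_smul_le c f := sigma_smul μ R c f

instance : NonUnitalSeminormedRing (CcAlg μ R) :=
  { (inferInstance : SeminormedAddCommGroup (CcAlg μ R)),
    (inferInstance : NonUnitalRing (CcAlg μ R)) with
    norm_mul_le := fun f g => sigma_conv μ R f g }

instance : IsScalarTower ℝ (CcAlg μ R) (CcAlg μ R) where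
  smul_assoc c f g := smul_conv D μ c f g

instance : SMulCommClass ℝ (CcAlg μ R) (CcAlg μ R) where
  smul_comm c f g := (conv_smul D μ c f g).symm

/-- The normed algebra `C_c(G, A) / ker σ^R` (`SeparationQuotient` identifies `f` and `g` exactly
when `σ^R(f - g) = 0`), with the norm induced by `σ^R`. -/
abbrev CcQuotient : Type u := SeparationQuotient (CcAlg μ R)

end seminorm

end conv

/-! ### Completion of a non-unital normed algebra -/

section completion

open UniformSpace UniformSpace.Completion

variable (N : Type u) [NonUnitalNormedRing N]

/-- The product on the completion is the continuous extension of the product on `N`. -/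
@[reducible] def complMul : Mul (Completion N) :=
  ⟨Function.curry <| (isDenseInducing_coe.prodMap isDenseInducing_coe).extend
    (((↑) : N → Completion N) ∘ Function.uncurry (· * ·))⟩

theorem complMul_coe (a b : N) :
    (complMul N).mul (a : Completion N) b = ((a * b : N) : Completion N) :=
  (isDenseInducing_coe.prodMap isDenseInducing_coe).extend_eq
    ((continuous_coe N).comp (continuous_mul (M := N))) (a, b)

theorem continuous_complMul :
    Continuous fun p : Completion N × Completion N => (complMul N).mul p.1 p.2 := by
  let m := (AddMonoidHom.mul : N →+ N →+ N).compr₂ toCompl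
  have : Continuous fun p : N × N => m p.1 p.2 := (continuous_coe N).comp continuous_mul
  have di : IsDenseInducing (toCompl : N → Completion N) := isDenseInducing_coe
  exact (di.extend_Z_bilin di this :)

theorem continuous_complMul_comp {Z : Type w} [TopologicalSpace Z] {p q : Z → Completion N}
    (hp : Continuous p) (hq : Continuous q) : Continuous fun z => (complMul N).mul (p z) (q z) :=
  (continuous_complMul N).comp (hp.prodMk hq)

/-- The completion of a normed algebra is a Banach algebra. -/
@[reducible] def complNonUnitalNormedRing : NonUnitalNormedRing (Completion N) :=
  { (inferInstance : NormedAddCommGroup (Completion N)), complMul N with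
    zero_mul := fun a => Completion.induction_on a
      (isClosed_eq (continuous_complMul_comp N continuous_const continuous_id) continuous_const)
      fun a => by
        change (complMul N).mul _ _ = _
        rw [← coe_zero, complMul_coe, zero_mul]
    mul_zero := fun a => Completion.induction_on a
      (isClosed_eq (continuous_complMul_comp N continuous_id continuous_const) continuous_const)
      fun a => by
        change (complMul N).mul _ _ = _
        rw [← coe_zero, complMul_coe, mul_zero]
    mul_assoc := fun a b c => Completion.induction_on₃ a b c
      (isClosed_eq
        (continuous_complMul_comp N (continuous_complMul_comp N (by fun_prop) (by fun_prop))
          (by fun_prop))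
        (continuous_complMul_comp N (by fun_prop)
          (continuous_complMul_comp N (by fun_prop) (by fun_prop))))
      fun a b c => by
        change (complMul N).mul ((complMul N).mul _ _) _ = (complMul N).mul _ ((complMul N).mul _ _)
        simp only [complMul_coe, mul_assoc]
    left_distrib := fun a b c => Completion.induction_on₃ a b c
      (isClosed_eq
        (continuous_complMul_comp N (by fun_prop) (by fun_prop))
        ((continuous_complMul_comp N (by fun_prop) (by fun_prop)).add
          (continuous_complMul_comp N (by fun_prop) (by fun_prop))))
      fun a b c => by
        change (complMul N).mul _ _ = (complMul N).mul _ _ + (complMul N).mul _ _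
        simp only [← coe_add, complMul_coe, mul_add]
    right_distrib := fun a b c => Completion.induction_on₃ a b c
      (isClosed_eq
        (continuous_complMul_comp N (by fun_prop) (by fun_prop))
        ((continuous_complMul_comp N (by fun_prop) (by fun_prop)).add
          (continuous_complMul_comp N (by fun_prop) (by fun_prop))))
      fun a b c => by
        change (complMul N).mul _ _ = (complMul N).mul _ _ + (complMul N).mul _ _
        simp only [← coe_add, complMul_coe, add_mul]
    norm_mul_le := fun a b => Completion.induction_on₂ a b
      (isClosed_le (continuous_complMul_comp N (by fun_prop) (by fun_prop)).norm (by fun_prop))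
      fun a b => by
        change ‖(complMul N).mul _ _‖ ≤ _
        rw [complMul_coe]
        simpa only [norm_coe] using norm_mul_le a b }

end completion

section crossedProduct

variable [IsScalarTower ℝ A A] [SMulCommClass ℝ A A] [CompleteSpace A] [IsTopologicalGroup G]
  [LocallyCompactSpace G] [T2Space G] [MeasurableSpace G] [BorelSpace G]

variable {D : DynSystem A G} (μ : Measure G) [μ.IsHaarMeasure] (R : UniformlyBoundedClass D)

/-- The crossed product: the completion of `C_c(G, A) / ker σ^R`. -/
def CrossedProduct : Type u := UniformSpace.Completion (CcQuotient μ R)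

instance : NonUnitalNormedRing (CrossedProduct μ R) := complNonUnitalNormedRing (CcQuotient μ R)

instance : NormedSpace ℝ (CrossedProduct μ R) where
  toModule := inferInstanceAs (Module ℝ (UniformSpace.Completion (CcQuotient μ R)))
  norm_smul_le := norm_smul_le (α := ℝ) (β := UniformSpace.Completion (CcQuotient μ R))

instance : CompleteSpace (CrossedProduct μ R) :=
  inferInstanceAs (CompleteSpace (UniformSpace.Completion (CcQuotient μ R)))

/-- The map `q^R` from `C_c(G, A)` to the crossed product. -/
def qL : CcAlg μ R →L[ℝ] CrossedProduct μ R :=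
  (UniformSpace.Completion.toComplL (𝕜 := ℝ) (E := CcQuotient μ R)).comp
    (SeparationQuotient.mkCLM ℝ (CcAlg μ R))

/-- The element `q^R(f)` of the crossed product. -/
def q (f : C_c(G, A)) : CrossedProduct μ R := qL μ R (toCcAlg μ R f)

theorem norm_q (f : C_c(G, A)) : ‖q μ R f‖ = sigma μ R f :=
  UniformSpace.Completion.norm_coe (SeparationQuotient.mk (toCcAlg μ R f))

theorem isUniformInducing_qL : IsUniformInducing (qL μ R) :=
  (AddMonoidHomClass.isometry_of_norm (qL μ R) (norm_q μ R)).isUniformInducing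

theorem denseRange_qL : DenseRange (qL μ R) :=
  (UniformSpace.Completion.denseRange_coe (α := CcQuotient μ R)).comp
    SeparationQuotient.surjective_mk.denseRange (UniformSpace.Completion.continuous_coe _)

theorem denseRange_q : DenseRange (q μ R) := denseRange_qL μ R

theorem qL_mul (f g : CcAlg μ R) : qL μ R (f * g) = qL μ R f * qL μ R g :=
  (complMul_coe (CcQuotient μ R) (SeparationQuotient.mk f) (SeparationQuotient.mk g)).symm

theorem q_conv (f g : C_c(G, A)) : q μ R (conv D μ f g) = q μ R f * q μ R g :=
  qL_mul μ R f g

theorem smul_mul_crossed (c : ℝ) (x y : CrossedProduct μ R) : c • x * y = c • (x * y) := by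
  have h1 : Continuous fun p : CrossedProduct μ R × CrossedProduct μ R => c • p.1 * p.2 :=
    (continuous_fst.const_smul c).mul continuous_snd
  have h2 : Continuous fun p : CrossedProduct μ R × CrossedProduct μ R => c • (p.1 * p.2) :=
    (continuous_fst.mul continuous_snd).const_smul c
  refine congrFun (((denseRange_qL μ R).prodMap (denseRange_qL μ R)).equalizer h1 h2
    (funext fun p => ?_)) (x, y)
  change c • qL μ R p.1 * qL μ R p.2 = c • (qL μ R p.1 * qL μ R p.2)
  rw [← map_smul, ← qL_mul, ← qL_mul, ← map_smul, smul_mul_assoc]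

theorem mul_smul_crossed (c : ℝ) (x y : CrossedProduct μ R) : x * c • y = c • (x * y) := by
  have h1 : Continuous fun p : CrossedProduct μ R × CrossedProduct μ R => p.1 * c • p.2 :=
    continuous_fst.mul (continuous_snd.const_smul c)
  have h2 : Continuous fun p : CrossedProduct μ R × CrossedProduct μ R => c • (p.1 * p.2) :=
    (continuous_fst.mul continuous_snd).const_smul c
  refine congrFun (((denseRange_qL μ R).prodMap (denseRange_qL μ R)).equalizer h1 h2
    (funext fun p => ?_)) (x, y)
  change qL μ R p.1 * c • qL μ R p.2 = c • (qL μ R p.1 * qL μ R p.2)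
  rw [← map_smul, ← qL_mul, ← qL_mul, ← map_smul, mul_smul_comm]

instance : IsScalarTower ℝ (CrossedProduct μ R) (CrossedProduct μ R) where
  smul_assoc := smul_mul_crossed μ R

instance : SMulCommClass ℝ (CrossedProduct μ R) (CrossedProduct μ R) where
  smul_comm c x y := (mul_smul_crossed μ R c x y).symm

/-- The cone `C_c(G, A₊)` of `C_c(G, A)`. -/
def ccCone (D : DynSystem A G) : PointedCone ℝ C_c(G, A) where
  carrier := {f | ∀ s, f s ∈ D.cone}
  add_mem' hf hg s := D.cone.add_mem (hf s) (hg s)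
  zero_mem' _ := D.cone.zero_mem
  smul_mem' c _ hf s := Submodule.smul_mem D.cone c (hf s)

/-- The cone of the crossed product: the closure of `q^R(C_c(G, A₊))`. -/
def crossedCone : PointedCone ℝ (CrossedProduct μ R) :=
  (PointedCone.map (qL μ R : CcAlg μ R →ₗ[ℝ] CrossedProduct μ R) (ccCone D)).closure

/-! ### The canonical pair of the crossed product -/

/-- `i_A(a) f = (s ↦ a f(s))`. -/
def iA₀ (a : A) (f : C_c(G, A)) : C_c(G, A) where
  toFun s := a * f s
  continuous_toFun := by fun_prop
  hasCompactSupport' := HasCompactSupport.intro f.hasCompactSupport fun s hs => by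
    simp [image_eq_zero_of_notMem_tsupport hs]

/-- `i_G(r) f = (s ↦ α_r(f(r⁻¹ s)))`. -/
def iG₀ (D : DynSystem A G) (r : G) (f : C_c(G, A)) : C_c(G, A) where
  toFun s := D.α r (f (r⁻¹ * s))
  continuous_toFun := (D.α r).continuous.comp (by fun_prop)
  hasCompactSupport' := by
    refine HasCompactSupport.intro
      (f.hasCompactSupport.isCompact.image (continuous_const_mul r)) fun s hs => ?_
    have : r⁻¹ * s ∉ tsupport f := fun h => hs ⟨r⁻¹ * s, h, by simp⟩
    simp [image_eq_zero_of_notMem_tsupport this]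

theorem iA₀_apply (a : A) (f : C_c(G, A)) (s : G) : iA₀ a f s = a * f s := rfl

theorem iG₀_apply (r : G) (f : C_c(G, A)) (s : G) : iG₀ D r f s = D.α r (f (r⁻¹ * s)) := rfl

theorem iG₀_one (f : C_c(G, A)) : iG₀ D 1 f = f :=
  CompactlySupportedContinuousMap.ext fun s => by
    simp only [iG₀_apply, map_one, inv_one, one_mul]
    rfl

theorem iG₀_mul (r t : G) (f : C_c(G, A)) : iG₀ D (r * t) f = iG₀ D r (iG₀ D t f) :=
  CompactlySupportedContinuousMap.ext fun s => by
    simp only [iG₀_apply, map_mul, mul_inv_rev, mul_assoc]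
    rfl

section

variable {X : Type v} [NormedAddCommGroup X] [NormedSpace ℝ X] [CompleteSpace X]
  {π : A →ₙₐ[ℝ] (X →L[ℝ] X)} {U : G →* (X →L[ℝ] X)}

theorem IsContCovRep.integrated_iA₀ (h : IsContCovRep D π U) (a : A) (f : C_c(G, A)) :
    h.integrated μ (iA₀ a f) = π a * h.integrated μ f := by
  ext x
  change _ = π a (h.integrated μ f x)
  rw [integrated_apply, integrated_apply, ← (π a).integral_comp_comm (h.integrable μ f x)]
  simp [iA₀_apply, map_mul]

theorem IsContCovRep.integrated_iG₀ (h : IsContCovRep D π U) (r : G) (f : C_c(G, A)) :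
    h.integrated μ (iG₀ D r f) = U r * h.integrated μ f := by
  ext x
  change _ = U r (h.integrated μ f x)
  rw [integrated_apply, integrated_apply, ← (U r).integral_comp_comm (h.integrable μ f x)]
  rw [← integral_mul_left_eq_self _ r]
  refine integral_congr_ae (Eventually.of_forall fun s => ?_)
  have hinv : U r⁻¹ (U r (U s x)) = U s x := by
    change (U r⁻¹ * U r) (U s x) = U s x
    rw [← map_mul]; simp
  simp [iG₀_apply, h.covariant, map_mul, hinv]

end

theorem exists_sigma_iA₀_le :
    ∃ C : ℝ, ∀ (a : A) (f : C_c(G, A)), sigma μ R (iA₀ a f) ≤ C * ‖a‖ * sigma μ R f := by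
  obtain ⟨C, ν, hC, hν, hνK, h⟩ := R.bounded
  refine ⟨C, fun a f => sigma_le μ R fun ρ hρ => ?_⟩
  rw [ρ.isContCovRep.integrated_iA₀ μ]
  exact (norm_mul_le _ _).trans (mul_le_mul ((h ρ hρ).1 a)
    (norm_integrated_le_sigma μ R hρ f) (norm_nonneg _) (by positivity))

theorem exists_sigma_iG₀_le (r : G) :
    ∃ C : ℝ, ∀ f : C_c(G, A), sigma μ R (iG₀ D r f) ≤ C * sigma μ R f := by
  obtain ⟨C, ν, hC, hν, hνK, h⟩ := R.bounded
  refine ⟨ν r, fun f => sigma_le μ R fun ρ hρ => ?_⟩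
  rw [ρ.isContCovRep.integrated_iG₀ μ]
  exact (norm_mul_le _ _).trans (mul_le_mul ((h ρ hρ).2 r)
    (norm_integrated_le_sigma μ R hρ f) (norm_nonneg _) (hν r))

theorem iA₀_add (a : A) (f g : C_c(G, A)) : iA₀ a (f + g) = iA₀ a f + iA₀ a g :=
  CompactlySupportedContinuousMap.ext fun s => by simp [iA₀_apply, mul_add]

theorem iA₀_smul (a : A) (c : ℝ) (f : C_c(G, A)) : iA₀ a (c • f) = c • iA₀ a f :=
  CompactlySupportedContinuousMap.ext fun s => by simp [iA₀_apply, mul_smul_comm]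

theorem iG₀_add (r : G) (f g : C_c(G, A)) : iG₀ D r (f + g) = iG₀ D r f + iG₀ D r g :=
  CompactlySupportedContinuousMap.ext fun s => by simp [iG₀_apply]

theorem iG₀_smul (r : G) (c : ℝ) (f : C_c(G, A)) : iG₀ D r (c • f) = c • iG₀ D r f :=
  CompactlySupportedContinuousMap.ext fun s => by simp [iG₀_apply]

/-- `i_A(a)` as a linear map. -/
def iAₗ (a : A) : CcAlg μ R →ₗ[ℝ] CcAlg μ R where
  toFun f := (iA₀ a f : C_c(G, A))
  map_add' f g := iA₀_add a f g
  map_smul' c f := iA₀_smul a c f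

/-- `i_G(r)` as a linear map. -/
def iGₗ (r : G) : CcAlg μ R →ₗ[ℝ] CcAlg μ R where
  toFun f := (iG₀ D r f : C_c(G, A))
  map_add' f g := iG₀_add r f g
  map_smul' c f := iG₀_smul r c f

/-- `i_A(a)` as a bounded operator for the seminorm `σ^R`. -/
def iA₁ (a : A) : CcAlg μ R →L[ℝ] CcAlg μ R :=
  { iAₗ μ R a with
    cont := by
      obtain ⟨C, hC⟩ := exists_sigma_iA₀_le μ R
      exact AddMonoidHomClass.continuous_of_bound (iAₗ μ R a) (C * ‖a‖) (hC a) }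

/-- `i_G(r)` as a bounded operator for the seminorm `σ^R`. -/
def iG₁ (r : G) : CcAlg μ R →L[ℝ] CcAlg μ R :=
  { iGₗ μ R r with
    cont := by
      obtain ⟨C, hC⟩ := exists_sigma_iG₀_le μ R r
      exact AddMonoidHomClass.continuous_of_bound (iGₗ μ R r) C hC }

/-- The bounded operator on the crossed product induced by an operator on `C_c(G, A)` that is
bounded for `σ^R`. -/
def liftOp (T : CcAlg μ R →L[ℝ] CcAlg μ R) : CrossedProduct μ R →L[ℝ] CrossedProduct μ R :=
  ((qL μ R).comp T).extend (qL μ R)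

theorem liftOp_qL (T : CcAlg μ R →L[ℝ] CcAlg μ R) (f : CcAlg μ R) :
    liftOp μ R T (qL μ R f) = qL μ R (T f) :=
  ContinuousLinearMap.extend_eq _ (denseRange_qL μ R) (isUniformInducing_qL μ R) f

theorem ext_of_qL {S T : CrossedProduct μ R →L[ℝ] CrossedProduct μ R}
    (h : ∀ f, S (qL μ R f) = T (qL μ R f)) : S = T :=
  ContinuousLinearMap.coeFn_injective
    ((denseRange_qL μ R).equalizer S.continuous T.continuous (funext h))

/-- `i_A^R`, as a homomorphism from `A` to the bounded operators on the crossed product. -/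
def iA : A →ₙₐ[ℝ] (CrossedProduct μ R →L[ℝ] CrossedProduct μ R) where
  toFun a := liftOp μ R (iA₁ μ R a)
  map_smul' c a := ext_of_qL μ R fun f => by
    change liftOp μ R _ _ = c • liftOp μ R _ _
    rw [liftOp_qL, liftOp_qL, ← map_smul]
    congr 1
    exact CompactlySupportedContinuousMap.ext fun s => smul_mul_assoc c a _
  map_zero' := ext_of_qL μ R fun f => by
    change liftOp μ R _ _ = 0
    rw [liftOp_qL, ← map_zero (qL μ R)]
    congr 1
    exact CompactlySupportedContinuousMap.ext fun s => zero_mul _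
  map_add' a b := ext_of_qL μ R fun f => by
    change liftOp μ R _ _ = liftOp μ R _ _ + liftOp μ R _ _
    rw [liftOp_qL, liftOp_qL, liftOp_qL, ← map_add]
    congr 1
    exact CompactlySupportedContinuousMap.ext fun s => add_mul a b _
  map_mul' a b := ext_of_qL μ R fun f => by
    change liftOp μ R _ _ = liftOp μ R _ (liftOp μ R _ _)
    rw [liftOp_qL, liftOp_qL, liftOp_qL]
    congr 1
    exact CompactlySupportedContinuousMap.ext fun s => mul_assoc a b _

/-- `i_G^R`, as a representation of `G` on the crossed product. -/
def iG : G →* (CrossedProduct μ R →L[ℝ] CrossedProduct μ R) where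
  toFun r := liftOp μ R (iG₁ μ R r)
  map_one' := ext_of_qL μ R fun f => by
    rw [liftOp_qL]
    exact congrArg (qL μ R) (iG₀_one f)
  map_mul' r t := ext_of_qL μ R fun f => by
    change liftOp μ R _ _ = liftOp μ R _ (liftOp μ R _ _)
    rw [liftOp_qL, liftOp_qL, liftOp_qL]
    exact congrArg (qL μ R) (iG₀_mul r t f)

theorem iA_q (a : A) (f : C_c(G, A)) : iA μ R a (q μ R f) = q μ R (iA₀ a f) :=
  liftOp_qL μ R (iA₁ μ R a) f

theorem iG_q (r : G) (f : C_c(G, A)) : iG μ R r (q μ R f) = q μ R (iG₀ D r f) :=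
  liftOp_qL μ R (iG₁ μ R r) f

end crossedProduct

/-! ### Left centralizers and generating triples -/

/-- The left centralizer algebra `M_l(E)`, as a subalgebra of the bounded operators on `E`. -/
def leftCentralizers (E : Type v) [NonUnitalNormedRing E] [NormedSpace ℝ E]
    [IsScalarTower ℝ E E] [SMulCommClass ℝ E E] : Subalgebra ℝ (E →L[ℝ] E) where
  carrier := {L | ∀ a b, L (a * b) = L a * b}
  mul_mem' {S T} hS hT a b := by
    change S (T (a * b)) = S (T a) * b
    rw [hT, hS]
  add_mem' {S T} hS hT a b := by
    change S (a * b) + T (a * b) = (S a + T a) * b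
    rw [hS, hT, add_mul]
  algebraMap_mem' c a b := by
    simp [Algebra.algebraMap_eq_smul_one, smul_mul_assoc]

section triples

variable {E : Type v} [NonUnitalNormedRing E] [NormedSpace ℝ E]
    [IsScalarTower ℝ E E] [SMulCommClass ℝ E E]

/-- The left regular representation `λ : E → M_l(E)`, `λ(a) b = a b`. -/
def leftRegular : E →ₙₐ[ℝ] leftCentralizers E where
  toFun a := ⟨ContinuousLinearMap.mul ℝ E a, fun b c => by
    simp [mul_assoc]⟩
  map_smul' c a := Subtype.ext (map_smul (ContinuousLinearMap.mul ℝ E) c a)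
  map_zero' := Subtype.ext (map_zero (ContinuousLinearMap.mul ℝ E))
  map_add' a b := Subtype.ext (map_add (ContinuousLinearMap.mul ℝ E) a b)
  map_mul' a b := Subtype.ext (ContinuousLinearMap.ext fun c => by
    change a * b * c = a * (b * c)
    rw [mul_assoc])

/-- The cone `M_l(E)₊` of the positive left centralizers. -/
def positiveCentralizers (C : PointedCone ℝ E) : Set (leftCentralizers E) :=
  {L | (L : E →L[ℝ] E) ∈ positiveOperators C}

/-- `T` is a positive non-degenerate bounded representation, on a space with cone `CX`, of a
normed algebra `B` with set `P` of positive elements. -/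
structure IsPosNondegBddRep {B : Type w} [NonUnitalNormedRing B] [NormedSpace ℝ B] (P : Set B)
    {X : Type u} [NormedAddCommGroup X] [NormedSpace ℝ X] (CX : PointedCone ℝ X)
    (T : B →ₙₐ[ℝ] (X →L[ℝ] X)) : Prop where
  positive : ∀ b ∈ P, T b ∈ positiveOperators CX
  nondegenerate : IsNondegenerate T
  bounded : ∃ M : ℝ, ∀ b, ‖T b‖ ≤ M * ‖b‖

variable [IsScalarTower ℝ A A] [SMulCommClass ℝ A A] [CompleteSpace A] [IsTopologicalGroup G]
  [LocallyCompactSpace G] [T2Space G] [MeasurableSpace G] [BorelSpace G]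

/-- `(π, U)` is a positive non-degenerate `R`-continuous covariant representation of `(A, G, α)` on
the Banach space `X` with cone `CX`. -/
structure IsPosNondegRContRep {D : DynSystem A G} (μ : Measure G) [μ.IsHaarMeasure]
    (R : UniformlyBoundedClass D)
    {X : Type v} [NormedAddCommGroup X] [NormedSpace ℝ X] [CompleteSpace X] (CX : PointedCone ℝ X)
    (π : A →ₙₐ[ℝ] (X →L[ℝ] X)) (U : G →* (X →L[ℝ] X)) : Prop where
  isContCovRep : IsContCovRep D π U
  positive : IsPositiveCovRep D CX π U
  nondegenerate : IsNondegenerate π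
  isRContinuous : ∃ M : ℝ, ∀ f, ‖isContCovRep.integrated μ f‖ ≤ M * sigma μ R f

/-- `S` is a dense subset of `T`. -/
def IsDenseSubset {Y : Type v} [TopologicalSpace Y] (S T : Set Y) : Prop :=
  S ⊆ T ∧ T ⊆ closure S

end triples

section generating

variable [IsScalarTower ℝ A A] [SMulCommClass ℝ A A] [CompleteSpace A] [IsTopologicalGroup G]
  [LocallyCompactSpace G] [T2Space G] [MeasurableSpace G] [BorelSpace G]

/-- `(E, k_A, k_G)`, where the Banach algebra `E` has cone `CE`, is a generating triple for all
positive non-degenerate `R`-continuous covariant representations of `(A, G, α)` on pre-ordered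
Banach spaces with closed cones. -/
structure IsGeneratingTriple {D : DynSystem A G} (μ : Measure G) [μ.IsHaarMeasure]
    (R : UniformlyBoundedClass D)
    {E : Type u} [NonUnitalNormedRing E] [NormedSpace ℝ E]
    [IsScalarTower ℝ E E] [SMulCommClass ℝ E E] [CompleteSpace E] (CE : PointedCone ℝ E)
    (kA : A →ₙₐ[ℝ] (E →L[ℝ] E)) (kG : G →* (E →L[ℝ] E)) : Prop where
  isAlgebraCone : IsAlgebraCone CE
  isClosed_cone : IsClosed (CE : Set E)
  approxLeftIdentity : HasPosBddApproxLeftIdentity CE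
  /-- `λ` is a topological embedding. -/
  isEmbedding_leftRegular : IsEmbedding (leftRegular : E → leftCentralizers E)
  /-- `λ` is bipositive. -/
  bipositive_leftRegular : ∀ b : E, leftRegular b ∈ positiveCentralizers CE ↔ b ∈ CE
  rep : IsPosNondegRContRep μ R CE kA kG
  kA_mem : ∀ a, kA a ∈ leftCentralizers E
  kG_mem : ∀ s, kG s ∈ leftCentralizers E
  integrated_mem : ∀ f, ∃ b, rep.isContCovRep.integrated μ f = (leftRegular (E := E) b : E →L[ℝ] E)
  dense_integrated :
    IsDenseSubset (Set.range fun f => rep.isContCovRep.integrated μ f)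
      (Set.range fun b : E => (leftRegular (E := E) b : E →L[ℝ] E))
  dense_integrated_cone :
    IsDenseSubset ((fun f => rep.isContCovRep.integrated μ f) '' (ccCone D : Set C_c(G, A)))
      {L | (∃ b : E, L = (leftRegular (E := E) b : E →L[ℝ] E)) ∧ L ∈ leftCentralizers E ∧ L ∈ positiveOperators CE}
  /-- Every `(π, U)` arises as `(T̄ ∘ k_A, T̄ ∘ k_G)`, where `T̄ ∘ λ = T` for a representation `T`
  of `E`. (There is only one homomorphism `T̄` on `M_l(E)` with `T̄ ∘ λ = T`.) -/
  generates : ∀ (X : Type u) [NormedAddCommGroup X] [NormedSpace ℝ X] [CompleteSpace X]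
    (CX : PointedCone ℝ X), IsClosed (CX : Set X) →
    ∀ (π : A →ₙₐ[ℝ] (X →L[ℝ] X)) (U : G →* (X →L[ℝ] X)), IsPosNondegRContRep μ R CX π U →
    ∃ (T : E →ₙₐ[ℝ] (X →L[ℝ] X)) (Tbar : leftCentralizers E →ₙₐ[ℝ] (X →L[ℝ] X)),
      IsPosNondegBddRep (CE : Set E) CX T ∧
      IsPosNondegBddRep (positiveCentralizers CE) CX Tbar ∧
      (∀ b, Tbar (leftRegular b) = T b) ∧
      (∀ a, Tbar ⟨kA a, kA_mem a⟩ = π a) ∧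
      (∀ s, Tbar ⟨kG s, kG_mem s⟩ = U s)

/-- `ψ` is a topological isomorphism of Banach algebras from the crossed product onto `E` with
`k_A(a) = ψ i_A^R(a) ψ⁻¹` and `k_G(s) = ψ i_G^R(s) ψ⁻¹`. -/
structure IsInducingIso {D : DynSystem A G} (μ : Measure G) [μ.IsHaarMeasure]
    (R : UniformlyBoundedClass D) {E : Type u} [NonUnitalNormedRing E] [NormedSpace ℝ E]
    (kA : A →ₙₐ[ℝ] (E →L[ℝ] E)) (kG : G →* (E →L[ℝ] E))
    (ψ : CrossedProduct μ R ≃L[ℝ] E) : Prop where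
  map_mul : ∀ x y, ψ (x * y) = ψ x * ψ y
  induces_kA : ∀ a z, kA a z = ψ (iA μ R a (ψ.symm z))
  induces_kG : ∀ s z, kG s z = ψ (iG μ R s (ψ.symm z))

end generating

end OrderedCrossedProduct

end

namespace OrderedCrossedProduct

/-! ### Bounded nets of operators -/

section operators

variable {X : Type v} [NormedAddCommGroup X] [NormedSpace ℝ X]
  {Y : Type w} [NormedAddCommGroup Y] [NormedSpace ℝ Y]

/-! Existence. The extensions to the crossed product of the integrated forms of members of `R`
separate its points (`eq_of_forall_extension_eq`). Under such an extension `iA` and `iG` become left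
multiplication by `π a` and `U s`, so covariance, the centralizer property, and the identity "the
integrated form of the canonical pair is left multiplication by `q f`" (`integrated_canonical`)
reduce to facts about a single representation.

Positive bounded approximate identities of the crossed product come from functions `s ↦ z(s) e_i`,
where `z` is a probability density concentrated near the identity of `G` and `e_i` is an approximate
identity of `A`. The right one makes `λ` bounded below and bipositive. The left one extends
representations of the algebra to left centralizers, as strong limits of `T (L e_i)`. An
`R`-continuous pair has an integrated form that extends to the crossed product, and its centralizer
extension returns the pair.

Uniqueness. For a generating triple, `ψ (q f) = λ⁻¹ ((k_A ⋊ k_G)(f))` is bounded because the triple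
is `R`-continuous and `λ` is an embedding. Applying the universal property of `E` to the canonical
pair gives `T` with `T ∘ ψ = λ` on the crossed product, where `λ` is bounded below; hence so is `ψ`
(`IsGeneratingTriple.exists_norm_le`). Its range is closed, and dense by condition 3, so `ψ` is
onto. Condition 4 gives bipositivity. Any inducing isomorphism satisfies the same formula on the
dense range of `q`, so it equals `ψ`. -/

theorem tendsto_apply_of_dense_span {ι : Type*} {l : Filter ι} {F : ι → X →L[ℝ] Y}
    {F₀ : X →L[ℝ] Y} {M : ℝ} (hM : ∀ᶠ i in l, ‖F i‖ ≤ M) {S : Set X}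
    (hS : Dense (Submodule.span ℝ S : Set X))
    (h : ∀ x ∈ S, Tendsto (fun i => F i x) l (𝓝 (F₀ x))) (x : X) :
    Tendsto (fun i => F i x) l (𝓝 (F₀ x)) := by
  have h' : ∀ y ∈ Submodule.span ℝ S, Tendsto (fun i => F i y) l (𝓝 (F₀ y)) := by
    intro y hy
    induction hy using Submodule.span_induction with
    | mem y hy => exact h y hy
    | zero => simpa using tendsto_const_nhds
    | add y z _ _ hy hz => simpa using hy.add hz
    | smul c y _ hy => simpa using hy.const_smul c
  rw [Metric.tendsto_nhds]
  intro ε hε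
  -- The errors of `F i` and `F₀` on `x - y` total at most `K ‖x - y‖`; the summand `1` makes `K` a
  -- legitimate divisor.
  set K : ℝ := max M 0 + ‖F₀‖ + 1 with hK
  have hK0 : 0 < K := by positivity
  obtain ⟨y, hy, hxy⟩ := hS.exists_dist_lt x (ε := ε / 2 / K) (by positivity)
  filter_upwards [hM, (Metric.tendsto_nhds.1 (h' y hy)) (ε / 2) (by positivity)] with i hi hiy
  rw [dist_eq_norm] at hxy hiy ⊢
  have e : F i x - F₀ x = F i (x - y) + (F i y - F₀ y) - F₀ (x - y) := by
    simp only [map_sub]; abel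
  have h1 : ‖F i (x - y)‖ ≤ max M 0 * ‖x - y‖ :=
    (F i).le_of_opNorm_le (hi.trans (le_max_left _ _)) _
  have h2 : ‖F₀ (x - y)‖ ≤ ‖F₀‖ * ‖x - y‖ := F₀.le_opNorm _
  have h3 : K * ‖x - y‖ < ε / 2 := by
    rwa [lt_div_iff₀ hK0, mul_comm] at hxy
  have h4 : ‖F i x - F₀ x‖ ≤ ‖F i (x - y)‖ + ‖F i y - F₀ y‖ + ‖F₀ (x - y)‖ := by
    rw [e]
    exact (norm_sub_le _ _).trans (by gcongr; exact norm_add_le _ _)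
  have h5 := norm_nonneg (x - y)
  rw [hK] at h3
  linarith

/-- Uniform boundedness turns convergence on a total set into the Cauchy property at every vector,
and completeness supplies the limit. This constructs the operators that extend a representation to
left centralizers. -/
theorem exists_limit_operator [CompleteSpace Y] {ι : Type*} {l : Filter ι} [l.NeBot]
    {F : ι → X →L[ℝ] Y} {M : ℝ} (hM0 : 0 ≤ M) (hM : ∀ i, ‖F i‖ ≤ M) {S : Set X}
    (hS : Dense (Submodule.span ℝ S : Set X))
    (h : ∀ x ∈ S, ∃ y, Tendsto (fun i => F i x) l (𝓝 y)) :
    ∃ F₀ : X →L[ℝ] Y, ‖F₀‖ ≤ M ∧ ∀ x, Tendsto (fun i => F i x) l (𝓝 (F₀ x)) := by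
  have h' : ∀ x ∈ Submodule.span ℝ S, ∃ y, Tendsto (fun i => F i x) l (𝓝 y) := by
    intro x hx
    induction hx using Submodule.span_induction with
    | mem x hx => exact h x hx
    | zero => exact ⟨0, by simp⟩
    | add x y _ _ hx hy =>
      obtain ⟨a, ha⟩ := hx
      obtain ⟨b, hb⟩ := hy
      exact ⟨a + b, by simpa using ha.add hb⟩
    | smul c x _ hx =>
      obtain ⟨a, ha⟩ := hx
      exact ⟨c • a, by simpa using ha.const_smul c⟩
  have hex : ∀ x, ∃ y, Tendsto (fun i => F i x) l (𝓝 y) := by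
    intro x
    refine cauchy_map_iff_exists_tendsto.1 (Metric.cauchy_iff.2 ⟨inferInstance, fun ε hε => ?_⟩)
    -- Two errors of `ε / 4` place `F i x` in the ball of radius `ε / 2` about `y`, and any two
    -- points of that ball are less than `ε` apart.
    obtain ⟨x', hx', hd⟩ := hS.exists_dist_lt x (ε := ε / 4 / (M + 1)) (by positivity)
    obtain ⟨y, hy⟩ := h' x' hx'
    have hball : ∀ᶠ i in l, F i x ∈ Metric.ball y (ε / 2) := by
      filter_upwards [Metric.tendsto_nhds.1 hy (ε / 4) (by positivity)] with i hi
      have h1 : dist (F i x) (F i x') ≤ M * dist x x' := by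
        rw [dist_eq_norm, dist_eq_norm, ← map_sub]
        exact (F i).le_of_opNorm_le (hM i) _
      rw [lt_div_iff₀ (by positivity)] at hd
      have h2 := dist_triangle (F i x) (F i x') y
      have h3 : 0 ≤ dist x x' := dist_nonneg
      rw [Metric.mem_ball]
      nlinarith
    refine ⟨_, hball, fun a ha b hb => ?_⟩
    have := dist_triangle_right a b y
    have ha' := Metric.mem_ball.1 ha
    have hb' := Metric.mem_ball.1 hb
    linarith
  choose G hG using hex
  let L : X →ₗ[ℝ] Y := linearMapOfTendsto G (fun i => (F i : X →ₗ[ℝ] Y)) (l := l)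
    (tendsto_pi_nhds.2 hG)
  have hL : ∀ x, ‖L x‖ ≤ M * ‖x‖ := fun x =>
    le_of_tendsto (hG x).norm (Eventually.of_forall fun i => (F i).le_of_opNorm_le (hM i) x)
  exact ⟨L.mkContinuous M hL, L.mkContinuous_norm_le hM0 hL, hG⟩

/-- A bounded family is equicontinuous, so pointwise convergence is uniform on a small ball and
hence on compact sets. Applied to the compact set of values of a function in `C_c(G, A)`, it makes
approximate identities of `A` act uniformly. -/
theorem eventually_forall_norm_apply_sub_lt {ι : Type*} {l : Filter ι} {F : ι → X →L[ℝ] Y}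
    {F₀ : X →L[ℝ] Y} {M : ℝ} (hM : ∀ i, ‖F i‖ ≤ M)
    (h : ∀ x, Tendsto (fun i => F i x) l (𝓝 (F₀ x))) {K : Set X} (hK : IsCompact K)
    {ε : ℝ} (hε : 0 < ε) : ∀ᶠ i in l, ∀ x ∈ K, ‖F i x - F₀ x‖ < ε := by
  refine hK.induction_on (p := fun s => ∀ᶠ i in l, ∀ x ∈ s, ‖F i x - F₀ x‖ < ε) (by simp)
    (fun s t hst ht => ht.mono fun i hi x hx => hi x (hst hx))
    (fun s t hs ht => ?_) fun x _ => ?_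
  · filter_upwards [hs, ht] with i hi hi' x hx
    exact hx.elim (hi x) (hi' x)
  · set C : ℝ := max M 0 + ‖F₀‖ + 1 with hC
    have hC0 : 0 < C := by positivity
    refine ⟨Metric.ball x (ε / 2 / C), mem_nhdsWithin_of_mem_nhds
      (Metric.ball_mem_nhds _ (by positivity)), ?_⟩
    filter_upwards [Metric.tendsto_nhds.1 (h x) (ε / 2) (by positivity)] with i hi y hy
    rw [Metric.mem_ball, dist_eq_norm] at hy
    rw [dist_eq_norm] at hi
    have e : F i y - F₀ y = F i (y - x) + (F i x - F₀ x) - F₀ (y - x) := by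
      simp only [map_sub]; abel
    have h1 : ‖F i (y - x)‖ ≤ max M 0 * ‖y - x‖ :=
      (F i).le_of_opNorm_le ((hM i).trans (le_max_left _ _)) _
    have h2 : ‖F₀ (y - x)‖ ≤ ‖F₀‖ * ‖y - x‖ := F₀.le_opNorm _
    have h3 : C * ‖y - x‖ < ε / 2 := by
      rwa [lt_div_iff₀ hC0, mul_comm] at hy
    have h4 : ‖F i y - F₀ y‖ ≤ ‖F i (y - x)‖ + ‖F i x - F₀ x‖ + ‖F₀ (y - x)‖ := by
      rw [e]
      exact (norm_sub_le _ _).trans (by gcongr; exact norm_add_le _ _)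
    have h5 := norm_nonneg (y - x)
    rw [hC] at h3
    linarith

/-- A bounded net in `C` converging strongly to the identity, from approximation on finite subsets
of a dense set. -/
theorem exists_net_of_finite_approx {E : Type u} [NormedAddCommGroup E] [NormedSpace ℝ E]
    {C S : Set E} {Φ : E → E →L[ℝ] E} (hΦ : ∀ e, ‖Φ e‖ ≤ ‖e‖) (hS : Dense S) {M : ℝ}
    (h : ∀ F : Finset E, (F : Set E) ⊆ S → ∀ ε > 0, ∃ e ∈ C, ‖e‖ ≤ M ∧
      ∀ a ∈ F, ‖Φ e a - a‖ < ε) :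
    ∃ (ι : Type u) (_ : Preorder ι) (_ : IsDirectedOrder ι) (_ : Nonempty ι) (e : ι → E) (M : ℝ),
      (∀ i, e i ∈ C) ∧ (∀ i, ‖e i‖ ≤ M) ∧ ∀ a : E, Tendsto (fun i => Φ (e i) a) atTop (𝓝 a) := by
  classical
  -- The net is indexed by a finite set to be approximated together with `n`, the tolerance being `1
  -- / (n + 1)`.
  choose e heC heM he using fun i : Finset S × ℕ =>
    h (i.1.map (Function.Embedding.subtype _)) (by simp) (1 / ((i.2 : ℝ) + 1))
      Nat.one_div_pos_of_nat
  refine ⟨Finset S × ℕ, inferInstance, inferInstance, inferInstance, e, M, heC, heM, fun a => ?_⟩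
  refine tendsto_apply_of_dense_span (F₀ := ContinuousLinearMap.id ℝ E) (M := M)
    (Eventually.of_forall fun i => (hΦ _).trans (heM i)) (hS.mono Submodule.subset_span)
    (fun x hx => ?_) a
  rw [Metric.tendsto_nhds]
  intro ε hε
  obtain ⟨n, hn⟩ := exists_nat_one_div_lt hε
  filter_upwards [eventually_ge_atTop (({⟨x, hx⟩}, n) : Finset S × ℕ)] with i hi
  rw [dist_eq_norm]
  have hx' : (⟨x, hx⟩ : S) ∈ i.1 := hi.1 (by simp)
  refine (he i x (by simpa using ⟨hx, hx'⟩)).trans (lt_of_le_of_lt ?_ hn)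
  exact Nat.one_div_le_one_div hi.2

end operators

/-! ### Integrals of cone-valued functions -/

section cones

variable {V : Type v} [NormedAddCommGroup V] [NormedSpace ℝ V] [CompleteSpace V]

/-- Otherwise Hahn–Banach separates the integral from the cone by a functional `g`. A functional
bounded above on a cone is nonpositive there, so `g` of the integral is nonpositive, whereas
separation makes it exceed `t > 0`. -/
theorem integral_mem_cone {Z : Type w} [MeasurableSpace Z] {μ : Measure Z} {C : PointedCone ℝ V}
    (hC : IsClosed (C : Set V)) {f : Z → V} (hf : ∀ z, f z ∈ C) :
    ∫ z, f z ∂μ ∈ C := by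
  by_cases hi : Integrable f μ
  swap
  -- The integral of a non-integrable function is `0` by convention, which lies in the cone.
  · rw [integral_undef hi]
    exact C.zero_mem
  by_contra hn
  obtain ⟨g, t, hg, ht⟩ := geometric_hahn_banach_closed_point
    (PointedCone.toConvexCone C).convex hC (x := ∫ z, f z ∂μ) hn
  have ht0 : 0 < t := by simpa using hg 0 C.zero_mem
  have hneg : ∀ c ∈ C, g c ≤ 0 := by
    intro c hc
    by_contra! hpos
    have := hg ((t / g c) • c) (C.smul_mem (by positivity) hc)
    rw [map_smul, smul_eq_mul, div_mul_cancel₀ _ hpos.ne'] at this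
    exact lt_irrefl _ this
  have h1 : g (∫ z, f z ∂μ) = ∫ z, g (f z) ∂μ := (g.integral_comp_comm hi).symm
  have h2 : ∫ z, g (f z) ∂μ ≤ 0 := integral_nonpos fun z => hneg _ (hf z)
  linarith

end cones

end OrderedCrossedProduct

namespace OrderedCrossedProduct

variable {A G : Type u} [NonUnitalNormedRing A] [NormedSpace ℝ A]
  [Group G] [TopologicalSpace G]
  [IsScalarTower ℝ A A] [SMulCommClass ℝ A A] [CompleteSpace A] [IsTopologicalGroup G]
  [LocallyCompactSpace G] [T2Space G] [MeasurableSpace G] [BorelSpace G]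

/-! ### Approximation of the point mass at the identity -/

/-- `z` is a symmetric probability density that vanishes outside `V`. -/
structure IsBump (μ : Measure G) (z : C_c(G, ℝ)) (V : Set G) : Prop where
  nonneg : ∀ r, 0 ≤ z r
  symm : ∀ r, z r⁻¹ = z r
  eq_zero : ∀ r ∉ V, z r = 0
  integral_eq_one : ∫ r, z r ∂μ = 1

/-- A Urysohn function `w` is symmetrized as `w r * w r⁻¹` and then normalized. Symmetry is what
keeps the modular function out of the later convolution estimate, although `G` need not be
unimodular. -/
theorem exists_isBump (μ : Measure G) [μ.IsHaarMeasure] {V : Set G} (hV : V ∈ 𝓝 (1 : G)) :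
    ∃ z, IsBump μ z V := by
  obtain ⟨w, hw1, hw0, hwc, hw⟩ := exists_continuous_one_zero_of_isCompact
    (isCompact_singleton (x := (1 : G))) (t := (interior V)ᶜ) isOpen_interior.isClosed_compl
    (by simpa [Set.disjoint_left] using mem_interior_iff_mem_nhds.2 hV)
  have hw1' : w 1 = 1 := hw1 rfl
  have hcont : Continuous fun r => w r * w r⁻¹ := by fun_prop
  have hsupp : HasCompactSupport fun r => w r * w r⁻¹ := hwc.mul_right
  have hnn : ∀ r, 0 ≤ w r * w r⁻¹ := fun r => mul_nonneg (hw r).1 (hw r⁻¹).1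
  have hpos : 0 < ∫ r, w r * w r⁻¹ ∂μ :=
    hcont.integral_pos_of_hasCompactSupport_nonneg_nonzero hsupp hnn (x := 1) (by simp [hw1'])
  let z : C_c(G, ℝ) := ⟨⟨fun r => w r * w r⁻¹, hcont⟩, hsupp⟩
  have hz : ∀ r, ((∫ r, w r * w r⁻¹ ∂μ)⁻¹ • z) r = (∫ r, w r * w r⁻¹ ∂μ)⁻¹ * (w r * w r⁻¹) :=
    fun r => rfl
  refine ⟨(∫ r, w r * w r⁻¹ ∂μ)⁻¹ • z, fun r => ?_, fun r => ?_, fun r hr => ?_, ?_⟩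
  · rw [hz]
    exact mul_nonneg (inv_nonneg.2 hpos.le) (hnn r)
  · rw [hz, hz, inv_inv, mul_comm (w r⁻¹)]
  · have : w r = 0 := hw0 fun h => hr (interior_subset h)
    rw [hz, this, zero_mul, mul_zero]
  · simp only [hz]
    rw [integral_const_mul, inv_mul_cancel₀ hpos.ne']

/-- The function `s ↦ z(s) a`. -/
def tensor (z : C_c(G, ℝ)) (a : A) : C_c(G, A) where
  toFun s := z s • a
  continuous_toFun := by fun_prop
  hasCompactSupport' := z.hasCompactSupport.smul_right

theorem tensor_apply (z : C_c(G, ℝ)) (a : A) (s : G) : tensor z a s = z s • a := rfl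

theorem IsBump.integrable {μ : Measure G} [μ.IsHaarMeasure] {z : C_c(G, ℝ)} {V : Set G}
    (_hz : IsBump μ z V) : Integrable (fun r => z r) μ :=
  z.continuous.integrable_of_hasCompactSupport z.hasCompactSupport

theorem IsBump.mono {μ : Measure G} {z : C_c(G, ℝ)} {V W : Set G} (hz : IsBump μ z V)
    (h : V ⊆ W) : IsBump μ z W :=
  ⟨hz.nonneg, hz.symm, fun r hr => hz.eq_zero r fun hr' => hr (h hr'), hz.integral_eq_one⟩

theorem IsBump.tensor_mem_ccCone {D : DynSystem A G} {μ : Measure G} {z : C_c(G, ℝ)} {V : Set G}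
    (hz : IsBump μ z V) {a : A} (ha : a ∈ D.cone) : tensor z a ∈ ccCone D :=
  fun s => D.cone.smul_mem (hz.nonneg s) ha

/-- Since `z` has mass one, the difference is the average of `π a (U r x - x)` with weight `z`,
which lives on `V`. -/
theorem IsContCovRep.norm_integrated_tensor_sub_le {D : DynSystem A G} {X : Type v}
    [NormedAddCommGroup X] [NormedSpace ℝ X] [CompleteSpace X]
    {π : A →ₙₐ[ℝ] (X →L[ℝ] X)} {U : G →* (X →L[ℝ] X)} (h : IsContCovRep D π U) {μ : Measure G}
    [μ.IsHaarMeasure] {z : C_c(G, ℝ)} {V : Set G} (hz : IsBump μ z V) (a : A) {x : X} {δ : ℝ}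
    (hV : ∀ r ∈ V, ‖U r x - x‖ ≤ δ) :
    ‖h.integrated μ (tensor z a) x - π a x‖ ≤ ‖π a‖ * δ := by
  have h1 : π a x = ∫ r, z r • π a x ∂μ := by
    rw [integral_smul_const, hz.integral_eq_one, one_smul]
  have h2 : ∫ r, z r * (‖π a‖ * δ) ∂μ = ‖π a‖ * δ := by
    rw [integral_mul_const, hz.integral_eq_one, one_mul]
  rw [h.integrated_apply, h1, ← integral_sub (h.integrable μ _ x) (hz.integrable.smul_const _),
    ← h2]
  refine norm_integral_le_of_norm_le (hz.integrable.mul_const _) (Eventually.of_forall fun r => ?_)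
  by_cases hr : r ∈ V
  · have : π (tensor z a r) (U r x) - z r • π a x = z r • π a (U r x - x) := by
      simp [tensor_apply, smul_sub]
    rw [this, norm_smul, Real.norm_of_nonneg (hz.nonneg r)]
    exact mul_le_mul_of_nonneg_left ((π a).le_opNorm_of_le (hV r hr)) (hz.nonneg r)
  · simp [tensor_apply, hz.eq_zero r hr]

/-- The integrated form of a non-degenerate representation is non-degenerate. -/
theorem IsContCovRep.dense_span_integrated {D : DynSystem A G} {X : Type v}
    [NormedAddCommGroup X] [NormedSpace ℝ X] [CompleteSpace X]
    {π : A →ₙₐ[ℝ] (X →L[ℝ] X)} {U : G →* (X →L[ℝ] X)} (h : IsContCovRep D π U) (μ : Measure G)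
    [μ.IsHaarMeasure] (hπ : IsNondegenerate π) :
    Dense (Submodule.span ℝ {y : X | ∃ f x, y = h.integrated μ f x} : Set X) := by
  set S := Submodule.span ℝ {y : X | ∃ f x, y = h.integrated μ f x} with hS
  have key : Submodule.span ℝ {y : X | ∃ a x, y = π a x} ≤ S.topologicalClosure := by
    refine Submodule.span_le.2 ?_
    rintro _ ⟨a, x, rfl⟩
    refine Metric.mem_closure_iff.2 fun ε hε => ?_
    have hV : {r | ‖U r x - x‖ < ε / (‖π a‖ + 1)} ∈ 𝓝 (1 : G) := by
      have : Continuous fun r => ‖U r x - x‖ := ((h.strongly_continuous x).sub continuous_const).norm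
      exact this.continuousAt.eventually_lt continuousAt_const (by simpa using by positivity)
    obtain ⟨z, hz⟩ := exists_isBump μ hV
    refine ⟨h.integrated μ (tensor z a) x, Submodule.subset_span ⟨_, _, rfl⟩, ?_⟩
    rw [dist_comm, dist_eq_norm]
    refine (h.norm_integrated_tensor_sub_le hz a fun r hr => le_of_lt hr).trans_lt ?_
    rw [← mul_div_assoc, div_lt_iff₀ (by positivity)]
    nlinarith
  exact dense_closure.1 (hπ.mono key)

/-! ### Estimates for the seminorm -/

variable {D : DynSystem A G} (μ : Measure G) [μ.IsHaarMeasure] (R : UniformlyBoundedClass D)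

/-- The constant comes from the bounds that all members of `R` share: `C` times the supremum of `ν`
over `K`. It depends on `K` but not on `f`. -/
theorem exists_sigma_le_integral {K : Set G} (hK : IsCompact K) :
    ∃ C : ℝ, 0 ≤ C ∧ ∀ f : C_c(G, A), (∀ s ∉ K, f s = 0) → sigma μ R f ≤ C * ∫ r, ‖f r‖ ∂μ := by
  obtain ⟨C, ν, hC, hν, hνK, h⟩ := R.bounded
  obtain ⟨M, hM⟩ := hνK K hK
  refine ⟨C * max M 0, by positivity, fun f hf => sigma_le μ R fun ρ hρ => ?_⟩
  have hfK : tsupport f ⊆ K := closure_minimal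
    (fun s hs => by_contra fun hn => hs (hf s hn)) hK.isClosed
  refine ContinuousLinearMap.opNorm_le_bound _ ?_ fun x => ?_
  · have : 0 ≤ ∫ r, ‖f r‖ ∂μ := integral_nonneg fun r => norm_nonneg _
    positivity
  · exact ρ.isContCovRep.norm_integral_le μ f hC (h ρ hρ).1 (fun r hr =>
      ((h ρ hρ).2 r).trans ((hM ⟨r, hfK hr, rfl⟩).trans (le_max_left _ _))) x

theorem exists_sigma_le_sup {K : Set G} (hK : IsCompact K) :
    ∃ C : ℝ, 0 ≤ C ∧ ∀ (f : C_c(G, A)) (ε : ℝ), (∀ s ∉ K, f s = 0) → (∀ s ∈ K, ‖f s‖ ≤ ε) →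
      sigma μ R f ≤ C * ε := by
  obtain ⟨C, hC, h⟩ := exists_sigma_le_integral μ R hK
  refine ⟨C * μ.real K, by positivity, fun f ε hf hε => (h f hf).trans ?_⟩
  rw [mul_assoc]
  refine mul_le_mul_of_nonneg_left ?_ hC
  have h1 : ∫ r, ‖f r‖ ∂μ = ∫ r in K, ‖f r‖ ∂μ :=
    (setIntegral_eq_integral_of_forall_compl_eq_zero fun s hs => by simp [hf s hs]).symm
  rw [h1]
  have h2 : ∫ r in K, ‖f r‖ ∂μ ≤ ∫ r in K, ε ∂μ := by
    refine setIntegral_mono_on ?_ ?_ hK.measurableSet hε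
    · exact (f.continuous.integrable_of_hasCompactSupport f.hasCompactSupport).norm.integrableOn
    · exact integrableOn_const hK.measure_lt_top.ne
  simpa using h2

/-- The bound involves only the mass of `z`, not how concentrated `z` is; this is why the
approximate identities built from such functions are bounded. -/
theorem exists_norm_q_tensor_le {K : Set G} (hK : IsCompact K) :
    ∃ C : ℝ, 0 ≤ C ∧ ∀ (z : C_c(G, ℝ)) (a : A), IsBump μ z K → ‖q μ R (tensor z a)‖ ≤ C * ‖a‖ := by
  obtain ⟨C, hC, h⟩ := exists_sigma_le_integral μ R hK
  refine ⟨C, hC, fun z a hz => ?_⟩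
  rw [norm_q]
  refine (h _ fun s hs => by simp [tensor_apply, hz.eq_zero s hs]).trans_eq ?_
  have : ∀ r, ‖tensor z a r‖ = z r * ‖a‖ := fun r => by
    rw [tensor_apply, norm_smul, Real.norm_of_nonneg (hz.nonneg r)]
  simp only [this]
  rw [integral_mul_const, hz.integral_eq_one, one_mul]

theorem q_sub (f g : C_c(G, A)) : q μ R (f - g) = q μ R f - q μ R g :=
  map_sub (qL μ R) (toCcAlg μ R f) (toCcAlg μ R g)

theorem tendsto_q {ι : Type*} {l : Filter ι} {K : Set G} (hK : IsCompact K)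
    {F : ι → C_c(G, A)} {f : C_c(G, A)} (hF : ∀ᶠ i in l, ∀ s ∉ K, F i s = f s)
    (h : ∀ ε > 0, ∀ᶠ i in l, ∀ s ∈ K, ‖F i s - f s‖ < ε) :
    Tendsto (fun i => q μ R (F i)) l (𝓝 (q μ R f)) := by
  obtain ⟨C, hC, hCK⟩ := exists_sigma_le_sup μ R hK
  rw [Metric.tendsto_nhds]
  intro ε hε
  filter_upwards [hF, h (ε / (C + 1)) (by positivity)] with i hi hi'
  rw [dist_eq_norm, ← q_sub, norm_q]
  refine (hCK _ (ε / (C + 1)) (fun s hs => ?_) fun s hs => ?_).trans_lt ?_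
  · simp [hi s hs]
  · simpa using (hi' s hs).le
  · rw [← mul_div_assoc, div_lt_iff₀ (by positivity)]
    nlinarith

theorem eventually_forall_norm_lt_of_isCompact {F : G → G → A}
    (hF : Continuous fun p : G × G => F p.1 p.2) (h1 : ∀ s, F 1 s = 0) {K : Set G}
    (hK : IsCompact K) {ε : ℝ} (hε : 0 < ε) : ∀ᶠ r in 𝓝 (1 : G), ∀ s ∈ K, ‖F r s‖ < ε :=
  hK.eventually_forall_of_forall_eventually fun s _ =>
    hF.norm.continuousAt.eventually_lt continuousAt_const (by simpa [h1] using hε)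

/-- The image of `tsupport f` under `f` is compact, so `e i * f s` tends to `f s` uniformly in `s`
there, and off `tsupport f` both vanish. -/
theorem tendsto_q_iA₀ {ι : Type*} {l : Filter ι} {e : ι → A} {M : ℝ} (hM : ∀ i, ‖e i‖ ≤ M)
    (he : ∀ a, Tendsto (fun i => e i * a) l (𝓝 a)) (f : C_c(G, A)) :
    Tendsto (fun i => q μ R (iA₀ (e i) f)) l (𝓝 (q μ R f)) := by
  refine tendsto_q μ R f.hasCompactSupport.isCompact (Eventually.of_forall fun i s hs => ?_)
    fun ε hε => ?_
  · simp [iA₀_apply, image_eq_zero_of_notMem_tsupport hs]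
  · have := eventually_forall_norm_apply_sub_lt
      (F := fun i => ContinuousLinearMap.mul ℝ A (e i)) (F₀ := ContinuousLinearMap.id ℝ A)
      (fun i => (ContinuousLinearMap.opNorm_mul_apply_le ℝ A _).trans (hM i)) he
      (f.hasCompactSupport.isCompact.image f.continuous) hε
    filter_upwards [this] with i hi s hs
    exact hi _ ⟨s, hs, rfl⟩

theorem tendsto_q_iG₀ (f : C_c(G, A)) :
    Tendsto (fun r => q μ R (iG₀ D r f)) (𝓝 1) (𝓝 (q μ R f)) := by
  obtain ⟨K, hK, hK1⟩ := exists_compact_mem_nhds (1 : G)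
  -- This set supports every translate of `f` by an element of `K`, including `f` itself because `1
  -- ∈ K`.
  have hc : IsCompact ((fun p : G × G => p.1 * p.2) '' (K ×ˢ tsupport f)) :=
    (hK.prod f.hasCompactSupport.isCompact).image continuous_mul
  refine tendsto_q μ R hc ?_ fun ε hε => ?_
  · filter_upwards [hK1] with r hr s hs
    have h1 : r⁻¹ * s ∉ tsupport f := fun h => hs ⟨(r, r⁻¹ * s), ⟨hr, h⟩, by simp⟩
    have h2 : s ∉ tsupport f := fun h => hs ⟨(1, s), ⟨mem_of_mem_nhds hK1, h⟩, by simp⟩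
    simp [iG₀_apply, image_eq_zero_of_notMem_tsupport h1, image_eq_zero_of_notMem_tsupport h2]
  · refine eventually_forall_norm_lt_of_isCompact (F := fun r s => iG₀ D r f s - f s) ?_
      (fun s => by simp [iG₀_one]) hc hε
    have h1 : Continuous fun p : G × G => f p.2 := by fun_prop
    exact (D.continuous_α_apply (p := fun p : G × G => p.1)
      (x := fun p => f (p.1⁻¹ * p.2)) (by fun_prop) (by fun_prop)).sub h1

/-- At `s` the difference is the average, with weight `z (r⁻¹ * s)`, of `(f r * α_r(e i) - f r) + (f
r - f s)`. The first term is small uniformly in `r` because `e` is an approximate right identity,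
the second because `r⁻¹ * s` is near `1`. The neighbourhood is chosen before `i`, so it can be
intersected over finitely many `f`. -/
theorem eventually_norm_q_mul_tensor_sub_lt {ι : Type*} {l : Filter ι} {e : ι → A} {M : ℝ}
    (hM : ∀ i, ‖e i‖ ≤ M) (he : ∀ a, Tendsto (fun i => a * e i) l (𝓝 a)) (f : C_c(G, A))
    {ε : ℝ} (hε : 0 < ε) :
    ∃ V ∈ 𝓝 (1 : G), ∀ᶠ i in l, ∀ z, IsBump μ z V →
      ‖q μ R f * q μ R (tensor z (e i)) - q μ R f‖ < ε := by
  obtain ⟨K, hK, hK1⟩ := exists_compact_mem_nhds (1 : G)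
  have hfc := f.hasCompactSupport.isCompact
  have hc : IsCompact ((fun p : G × G => p.1 * p.2) '' (tsupport f ×ˢ K)) :=
    (hfc.prod hK).image continuous_mul
  set L := (fun p : G × G => p.1 * p.2) '' (tsupport f ×ˢ K) with hL
  have hfL : ∀ s ∉ L, f s = 0 := fun s hs => image_eq_zero_of_notMem_tsupport fun h =>
    hs ⟨(s, 1), ⟨h, mem_of_mem_nhds hK1⟩, by simp⟩
  have hfLK : ∀ s ∉ L, ∀ t ∈ K, f (s * t⁻¹) = 0 := fun s hs t ht =>
    image_eq_zero_of_notMem_tsupport fun h => hs ⟨(s * t⁻¹, t), ⟨h, ht⟩, by simp⟩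
  obtain ⟨C, hC, hCL⟩ := exists_sigma_le_sup μ R hc
  -- Each of the two terms of the integrand is allowed half of the tolerance.
  set δ : ℝ := ε / (C + 1) / 2 with hδ
  have hδ0 : 0 < δ := by positivity
  have hV := eventually_forall_norm_lt_of_isCompact (F := fun t s => f (s * t⁻¹) - f s)
    (by fun_prop) (fun s => by simp) hc hδ0
  obtain ⟨N, hN0, hN⟩ := exists_norm_le_of_isCompact
    (V := fun s => (D.α s : A →L[ℝ] A)) D.continuous_α hfc
  -- Writing `f r * α_r(e i) = α_r(α_r⁻¹(f r) * e i)` reduces the first term to right multiplication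
  -- by `e i` on this compact set, up to the bound `N` for `α` on `tsupport f`.
  have hK' : IsCompact ((fun r => D.α r⁻¹ (f r)) '' tsupport f) :=
    hfc.image (D.continuous_α_apply continuous_inv (by fun_prop))
  refine ⟨_, inter_mem hK1 hV, ?_⟩
  have hE := eventually_forall_norm_apply_sub_lt
    (F := fun i => (ContinuousLinearMap.mul ℝ A).flip (e i)) (F₀ := ContinuousLinearMap.id ℝ A)
    (fun i => (ContinuousLinearMap.opNorm_le_bound _ (norm_nonneg _) fun a => by
      simpa [mul_comm] using norm_mul_le a (e i)).trans (hM i)) he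
    hK' (ε := δ / (N + 1)) (by positivity)
  filter_upwards [hE] with i hi z hz
  have hA : ∀ r, ‖f r * D.α r (e i) - f r‖ ≤ δ := by
    intro r
    by_cases hr : r ∈ tsupport f
    · have h1 := hi _ ⟨r, hr, rfl⟩
      have hinv : D.α r (D.α r⁻¹ (f r)) = f r := by
        change (D.α r * D.α r⁻¹) (f r) = f r
        rw [← map_mul, mul_inv_cancel, map_one]
        rfl
      have h2 : f r * D.α r (e i) - f r = D.α r (D.α r⁻¹ (f r) * e i - D.α r⁻¹ (f r)) := by
        rw [map_sub, D.α_mul, hinv]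
      rw [h2]
      refine ((D.α r : A →L[ℝ] A).le_of_opNorm_le (hN r hr) _).trans ?_
      refine (mul_le_mul_of_nonneg_left (le_of_lt h1) hN0).trans ?_
      rw [← mul_div_assoc, div_le_iff₀ (by positivity)]
      nlinarith
    · simp [image_eq_zero_of_notMem_tsupport hr, hδ0.le]
  rw [← q_conv, ← q_sub, norm_q]
  refine (hCL _ (ε / (C + 1)) (fun s hs => ?_) fun s hs => ?_).trans_lt ?_
  · have : ∀ r, f r * D.α r (tensor z (e i) (r⁻¹ * s)) = 0 := by
      intro r
      by_cases hr : r⁻¹ * s ∈ K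
      · have := hfLK s hs _ hr
        simp only [mul_inv_rev, inv_inv, mul_inv_cancel_left] at this
        rw [this, zero_mul]
      · simp [tensor_apply, hz.eq_zero (r⁻¹ * s) fun h => hr h.1]
    simp [conv_apply, this, hfL s hs]
  -- Symmetry of `z` turns the weight into a left translate, so left invariance gives it mass one.
  · have hzs : ∀ r, z (r⁻¹ * s) = z (s⁻¹ * r) := fun r => by
      rw [← hz.symm, mul_inv_rev, inv_inv]
    have hz1 : ∫ r, z (r⁻¹ * s) ∂μ = 1 := by
      simp only [hzs]
      rw [integral_mul_left_eq_self (fun r => z r), hz.integral_eq_one]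
    have hzi : Integrable (fun r => z (r⁻¹ * s)) μ := by
      simp only [hzs]
      exact hz.integrable.comp_mul_left s⁻¹
    have h1 : f s = ∫ r, z (r⁻¹ * s) • f s ∂μ := by
      rw [integral_smul_const, hz1, one_smul]
    have h2 : ∫ r, z (r⁻¹ * s) * (ε / (C + 1)) ∂μ = ε / (C + 1) := by
      rw [integral_mul_const, hz1, one_mul]
    rw [CompactlySupportedContinuousMap.sub_apply, conv_apply, ← h2]
    rw [h1]
    rw [← integral_sub (integrable_conv D μ _ _ s) (hzi.smul_const _)]
    refine norm_integral_le_of_norm_le (hzi.mul_const _) (Eventually.of_forall fun r => ?_)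
    by_cases hr : r⁻¹ * s ∈ K ∩ {t | ∀ s ∈ L, ‖f (s * t⁻¹) - f s‖ < δ}
    · have e1 : f r * D.α r (tensor z (e i) (r⁻¹ * s)) - z (r⁻¹ * s) • f s
          = z (r⁻¹ * s) • ((f r * D.α r (e i) - f r) + (f r - f s)) := by
        simp only [tensor_apply, map_smul, mul_smul_comm, smul_sub, smul_add]
        abel
      rw [e1, norm_smul, Real.norm_of_nonneg (hz.nonneg _)]
      refine mul_le_mul_of_nonneg_left ?_ (hz.nonneg _)
      have h3 := hr.2 s hs
      simp only [mul_inv_rev, inv_inv, mul_inv_cancel_left] at h3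
      refine (norm_add_le _ _).trans ((add_le_add (hA r) h3.le).trans_eq ?_)
      rw [hδ]; ring
    · simp [tensor_apply, hz.eq_zero _ hr]
  · rw [← mul_div_assoc, div_lt_iff₀ (by positivity)]
    nlinarith

end OrderedCrossedProduct

namespace OrderedCrossedProduct

variable {A G : Type u} [NonUnitalNormedRing A] [NormedSpace ℝ A]
  [Group G] [TopologicalSpace G]
  [IsScalarTower ℝ A A] [SMulCommClass ℝ A A] [CompleteSpace A] [IsTopologicalGroup G]
  [LocallyCompactSpace G] [T2Space G] [MeasurableSpace G] [BorelSpace G]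
  {D : DynSystem A G} (μ : Measure G) [μ.IsHaarMeasure] (R : UniformlyBoundedClass D)

/-! ### The cone of the crossed product -/

theorem q_mem_crossedCone {f : C_c(G, A)} (hf : f ∈ ccCone D) : q μ R f ∈ crossedCone μ R :=
  subset_closure ⟨f, hf, rfl⟩

theorem crossedCone_subset_of_isClosed {P : Set (CrossedProduct μ R)} (hP : IsClosed P)
    (h : ∀ f ∈ ccCone D, q μ R f ∈ P) : (crossedCone μ R : Set (CrossedProduct μ R)) ⊆ P :=
  closure_minimal (by rintro _ ⟨f, hf, rfl⟩; exact h f hf) hP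

theorem isClosed_crossedCone : IsClosed (crossedCone μ R : Set (CrossedProduct μ R)) :=
  isClosed_closure

theorem crossed_induction {P : CrossedProduct μ R → Prop} (hP : IsClosed {x | P x})
    (h : ∀ f, P (q μ R f)) (x : CrossedProduct μ R) : P x :=
  isClosed_property (denseRange_q μ R) hP h x

theorem isClosed_positiveOperators {X : Type v} [NormedAddCommGroup X] [NormedSpace ℝ X]
    {C : PointedCone ℝ X} (hC : IsClosed (C : Set X)) : IsClosed (positiveOperators C) := by
  have : positiveOperators C = ⋂ x ∈ C, {T : X →L[ℝ] X | T x ∈ C} := by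
    ext T; simp [positiveOperators]
  rw [this]
  exact isClosed_biInter fun x _ => hC.preimage (by fun_prop : Continuous fun T : X →L[ℝ] X => T x)

theorem IsContCovRep.integrated_mem_positiveOperators {X : Type v} [NormedAddCommGroup X]
    [NormedSpace ℝ X] [CompleteSpace X] {π : A →ₙₐ[ℝ] (X →L[ℝ] X)} {U : G →* (X →L[ℝ] X)}
    (h : IsContCovRep D π U) {C : PointedCone ℝ X} (hC : IsClosed (C : Set X))
    (hp : IsPositiveCovRep D C π U) {f : C_c(G, A)} (hf : f ∈ ccCone D) :
    h.integrated μ f ∈ positiveOperators C := fun x hx => by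
  rw [h.integrated_apply]
  exact integral_mem_cone hC fun r => hp.1 _ (hf r) _ (hp.2 r _ hx)

/-! ### Extension of integrated forms to the crossed product -/

section extension

variable {X : Type v} [NormedAddCommGroup X] [NormedSpace ℝ X] [CompleteSpace X]
  {π : A →ₙₐ[ℝ] (X →L[ℝ] X)} {U : G →* (X →L[ℝ] X)}

/-- A linear map on `C_c(G, A)` that is bounded for `σ^R` extends to the crossed product. -/
theorem exists_extension {W : Type v} [NormedAddCommGroup W] [NormedSpace ℝ W] [CompleteSpace W]
    (φ : C_c(G, A) → W) (hadd : ∀ f g, φ (f + g) = φ f + φ g) (hsmul : ∀ (c : ℝ) f, φ (c • f) = c • φ f)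
    {M : ℝ} (hM : ∀ f, ‖φ f‖ ≤ M * sigma μ R f) :
    ∃ T : CrossedProduct μ R →L[ℝ] W, ∀ f, T (q μ R f) = φ f := by
  let φₗ : CcAlg μ R →ₗ[ℝ] W :=
    { toFun := fun f => φ f
      map_add' := hadd
      map_smul' := hsmul }
  exact ⟨(φₗ.mkContinuous M hM).extend (qL μ R), fun f =>
    ContinuousLinearMap.extend_eq _ (denseRange_qL μ R) (isUniformInducing_qL μ R) _⟩

theorem IsContCovRep.exists_extension (h : IsContCovRep D π U)
    (hM : ∃ M : ℝ, ∀ f, ‖h.integrated μ f‖ ≤ M * sigma μ R f) :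
    ∃ T : CrossedProduct μ R →L[ℝ] (X →L[ℝ] X), ∀ f, T (q μ R f) = h.integrated μ f :=
  let ⟨_, hM⟩ := hM
  OrderedCrossedProduct.exists_extension μ R _ (h.integrated_add μ) (h.integrated_smul μ) hM

variable {μ R}

theorem IsContCovRep.extension_mul (h : IsContCovRep D π U)
    {T : CrossedProduct μ R →L[ℝ] (X →L[ℝ] X)} (hT : ∀ f, T (q μ R f) = h.integrated μ f)
    (x y : CrossedProduct μ R) : T (x * y) = T x * T y := by
  refine crossed_induction μ R (P := fun x => T (x * y) = T x * T y)
    (isClosed_eq (by fun_prop) (by fun_prop)) (fun f => ?_) x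
  refine crossed_induction μ R (P := fun y => T (q μ R f * y) = T (q μ R f) * T y)
    (isClosed_eq (by fun_prop) (by fun_prop)) (fun g => ?_) y
  rw [← q_conv, hT, hT, hT, h.integrated_conv]

theorem IsContCovRep.extension_iA (h : IsContCovRep D π U)
    {T : CrossedProduct μ R →L[ℝ] (X →L[ℝ] X)} (hT : ∀ f, T (q μ R f) = h.integrated μ f)
    (a : A) (x : CrossedProduct μ R) : T (iA μ R a x) = π a * T x := by
  refine crossed_induction μ R (P := fun x => T (iA μ R a x) = π a * T x)
    (isClosed_eq (by fun_prop) (by fun_prop)) (fun f => ?_) x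
  rw [iA_q, hT, hT, h.integrated_iA₀ μ]

theorem IsContCovRep.extension_iG (h : IsContCovRep D π U)
    {T : CrossedProduct μ R →L[ℝ] (X →L[ℝ] X)} (hT : ∀ f, T (q μ R f) = h.integrated μ f)
    (s : G) (x : CrossedProduct μ R) : T (iG μ R s x) = U s * T x := by
  refine crossed_induction μ R (P := fun x => T (iG μ R s x) = U s * T x)
    (isClosed_eq (by fun_prop) (by fun_prop)) (fun f => ?_) x
  rw [iG_q, hT, hT, h.integrated_iG₀ μ]

theorem IsContCovRep.extension_mem_positiveOperators (h : IsContCovRep D π U)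
    {T : CrossedProduct μ R →L[ℝ] (X →L[ℝ] X)} (hT : ∀ f, T (q μ R f) = h.integrated μ f)
    {C : PointedCone ℝ X} (hC : IsClosed (C : Set X)) (hp : IsPositiveCovRep D C π U)
    {x : CrossedProduct μ R} (hx : x ∈ crossedCone μ R) : T x ∈ positiveOperators C :=
  crossedCone_subset_of_isClosed μ R ((isClosed_positiveOperators hC).preimage T.continuous)
    (fun f hf => by
      rw [Set.mem_preimage, hT]
      exact h.integrated_mem_positiveOperators μ hC hp hf) hx

/-- The extensions of the integrated forms of members of `R` separate the points of the crossed
product. -/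
theorem eq_of_forall_extension_eq {x y : CrossedProduct μ R}
    (h : ∀ ρ ∈ R.carrier, ∀ T : CrossedProduct μ R →L[ℝ] (ρ.X →L[ℝ] ρ.X),
      (∀ f, T (q μ R f) = ρ.isContCovRep.integrated μ f) → T x = T y) : x = y := by
  set w := x - y with hw
  -- Each extension `T` is contractive and kills `w`, so `‖T (q f)‖ = ‖T (q f - w)‖ ≤ ‖q f - w‖`;
  -- the supremum over `R` of the left sides is `‖q f‖`.
  have h1 : ∀ f, ‖q μ R f‖ ≤ ‖q μ R f - w‖ := by
    intro f
    rw [norm_q]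
    refine sigma_le μ R fun ρ hρ => ?_
    obtain ⟨T, hT⟩ := ρ.isContCovRep.exists_extension μ R
      ⟨1, fun f => by simpa using norm_integrated_le_sigma μ R hρ f⟩
    have hT1 : ∀ b, ‖T b‖ ≤ ‖b‖ := crossed_induction μ R
      (isClosed_le (by fun_prop) (by fun_prop)) fun f => by
        rw [hT, norm_q]
        exact norm_integrated_le_sigma μ R hρ f
    have hTw : T w = 0 := by rw [hw, map_sub, h ρ hρ T hT, sub_self]
    have := hT1 (q μ R f - w)
    rwa [map_sub, hTw, sub_zero, hT] at this
  by_contra hne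
  have hpos : 0 < ‖w‖ := norm_pos_iff.2 (sub_ne_zero.2 hne)
  -- Then `‖w‖ ≤ ‖q f‖ + ‖q f - w‖ ≤ 2 ‖q f - w‖ < ‖w‖`, which is absurd.
  obtain ⟨f, hf⟩ := (denseRange_q μ R).exists_dist_lt w (ε := ‖w‖ / 3) (by positivity)
  rw [dist_eq_norm, norm_sub_rev] at hf
  have h2 := norm_sub_norm_le w (q μ R f)
  rw [norm_sub_rev w] at h2
  linarith [h1 f]

end extension

/-! ### The canonical covariant representation -/

theorem exists_norm_iA_le : ∃ C : ℝ, 0 ≤ C ∧ ∀ a, ‖iA μ R a‖ ≤ C * ‖a‖ := by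
  obtain ⟨C, hC⟩ := exists_sigma_iA₀_le μ R
  refine ⟨max C 0, le_max_right _ _, fun a => ContinuousLinearMap.opNorm_le_bound _
    (by positivity) (crossed_induction μ R (isClosed_le (by fun_prop) (by fun_prop)) fun f => ?_)⟩
  rw [iA_q, norm_q, norm_q]
  refine (hC a f).trans ?_
  have := sigma_nonneg μ R f
  gcongr
  exact le_max_left _ _

theorem exists_norm_iG_le {K : Set G} (hK : IsCompact K) :
    ∃ M : ℝ, ∀ r ∈ K, ‖iG μ R r‖ ≤ M := by
  obtain ⟨C, ν, hC, hν, hνK, h⟩ := R.bounded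
  obtain ⟨M, hM⟩ := hνK K hK
  refine ⟨M, fun r hr => (ContinuousLinearMap.opNorm_le_bound _ (hν r) ?_).trans (hM ⟨r, hr, rfl⟩)⟩
  refine crossed_induction μ R (isClosed_le (by fun_prop) (by fun_prop)) fun f => ?_
  rw [iG_q, norm_q, norm_q]
  refine sigma_le μ R fun ρ hρ => ?_
  rw [ρ.isContCovRep.integrated_iG₀ μ]
  exact (norm_mul_le _ _).trans (mul_le_mul ((h ρ hρ).2 r)
    (norm_integrated_le_sigma μ R hρ f) (norm_nonneg _) (hν r))

theorem dense_span_range_q :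
    Dense (Submodule.span ℝ (Set.range (q μ R)) : Set (CrossedProduct μ R)) :=
  (denseRange_q μ R).mono Submodule.subset_span

theorem tendsto_iA {ι : Type*} {l : Filter ι} {e : ι → A} {M : ℝ} (hM : ∀ i, ‖e i‖ ≤ M)
    (he : ∀ a, Tendsto (fun i => e i * a) l (𝓝 a)) (x : CrossedProduct μ R) :
    Tendsto (fun i => iA μ R (e i) x) l (𝓝 x) := by
  obtain ⟨C, hC, h⟩ := exists_norm_iA_le μ R
  refine tendsto_apply_of_dense_span (F := fun i => iA μ R (e i))
    (F₀ := ContinuousLinearMap.id ℝ (CrossedProduct μ R)) (M := C * M)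
    (Eventually.of_forall fun i => (h _).trans (mul_le_mul_of_nonneg_left (hM i) hC))
    (dense_span_range_q μ R) ?_ x
  rintro _ ⟨f, rfl⟩
  simpa only [iA_q, ContinuousLinearMap.id_apply] using tendsto_q_iA₀ μ R hM he f

/-- Local boundedness reduces continuity at `1` to the dense range of `q`; the group law carries it
to any `s₀`, as `i_G(s) = i_G(s₀) i_G(s₀⁻¹ s)`. -/
theorem continuous_iG (x : CrossedProduct μ R) : Continuous fun s => iG μ R s x := by
  obtain ⟨K, hK, hK1⟩ := exists_compact_mem_nhds (1 : G)
  obtain ⟨M, hM⟩ := exists_norm_iG_le μ R hK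
  have h1 : ∀ x, Tendsto (fun s => iG μ R s x) (𝓝 1) (𝓝 x) := by
    refine tendsto_apply_of_dense_span (F := fun s => iG μ R s)
      (F₀ := ContinuousLinearMap.id ℝ (CrossedProduct μ R)) (M := M)
      (mem_of_superset hK1 hM) (dense_span_range_q μ R) ?_
    rintro _ ⟨f, rfl⟩
    simpa only [iG_q, ContinuousLinearMap.id_apply] using tendsto_q_iG₀ μ R f
  refine continuous_iff_continuousAt.2 fun s₀ => ?_
  have h2 : Tendsto (fun s => s₀⁻¹ * s) (𝓝 s₀) (𝓝 1) := by
    have : Continuous fun s => s₀⁻¹ * s := by fun_prop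
    simpa using this.tendsto s₀
  have h3 := ((iG μ R s₀).continuous.tendsto x).comp ((h1 x).comp h2)
  refine h3.congr fun s => ?_
  change (iG μ R s₀ * iG μ R (s₀⁻¹ * s)) x = _
  rw [← map_mul, mul_inv_cancel_left]

/-- Covariance is tested under the separating extensions, where it becomes the covariance of a
member of `R`. -/
theorem isContCovRep_canonical : IsContCovRep D (iA μ R) (iG μ R) where
  covariant s a := by
    ext x
    refine eq_of_forall_extension_eq fun ρ hρ T hT => ?_
    change _ = T (iG μ R s (iA μ R a (iG μ R s⁻¹ x)))
    rw [ρ.isContCovRep.extension_iA hT, ρ.isContCovRep.extension_iG hT,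
      ρ.isContCovRep.extension_iA hT, ρ.isContCovRep.extension_iG hT,
      ρ.isContCovRep.covariant]
    simp only [mul_assoc]
  bounded := let ⟨C, _, hC⟩ := exists_norm_iA_le μ R; ⟨C, hC⟩
  strongly_continuous := continuous_iG μ R

/-- The integrated form of the canonical pair is the left regular representation. -/
theorem integrated_canonical (f : C_c(G, A)) (x : CrossedProduct μ R) :
    (isContCovRep_canonical μ R).integrated μ f x = q μ R f * x := by
  -- Moving `T` inside the integral and evaluating at `y` makes both sides the integrated form of
  -- `ρ` applied to `T x y`.
  refine eq_of_forall_extension_eq fun ρ hρ T hT => ContinuousLinearMap.ext fun y => ?_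
  have h := ρ.isContCovRep
  have hi := (isContCovRep_canonical μ R).integrable μ f x
  rw [h.extension_mul hT, hT, IsContCovRep.integrated_apply, ← T.integral_comp_comm hi,
    ContinuousLinearMap.integral_apply (T.integrable_comp hi)]
  change _ = h.integrated μ f (T x y)
  rw [h.integrated_apply]
  refine integral_congr_ae (Eventually.of_forall fun r => ?_)
  simp only
  rw [h.extension_iA hT, h.extension_iG hT]
  rfl

theorem iA_mem_leftCentralizers (a : A) : iA μ R a ∈ leftCentralizers (CrossedProduct μ R) :=
  fun x y => eq_of_forall_extension_eq fun ρ _ T hT => by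
    rw [ρ.isContCovRep.extension_iA hT, ρ.isContCovRep.extension_mul hT,
      ρ.isContCovRep.extension_mul hT, ρ.isContCovRep.extension_iA hT, mul_assoc]

theorem iG_mem_leftCentralizers (s : G) : iG μ R s ∈ leftCentralizers (CrossedProduct μ R) :=
  fun x y => eq_of_forall_extension_eq fun ρ _ T hT => by
    rw [ρ.isContCovRep.extension_iG hT, ρ.isContCovRep.extension_mul hT,
      ρ.isContCovRep.extension_mul hT, ρ.isContCovRep.extension_iG hT, mul_assoc]

theorem isPositiveCovRep_canonical :
    IsPositiveCovRep D (crossedCone μ R) (iA μ R) (iG μ R) := by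
  refine ⟨fun a ha x hx => ?_, fun s x hx => ?_⟩
  · refine crossedCone_subset_of_isClosed μ R
      ((isClosed_crossedCone μ R).preimage (iA μ R a).continuous) (fun f hf => ?_) hx
    rw [Set.mem_preimage, iA_q]
    exact q_mem_crossedCone μ R fun r => D.isAlgebraCone a ha _ (hf r)
  · refine crossedCone_subset_of_isClosed μ R
      ((isClosed_crossedCone μ R).preimage (iG μ R s).continuous) (fun f hf => ?_) hx
    rw [Set.mem_preimage, iG_q]
    exact q_mem_crossedCone μ R fun r => D.α_mem_cone s _ (hf _)

theorem isPosNondegRContRep_canonical (hleft : HasPosBddApproxLeftIdentity D.cone) :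
    IsPosNondegRContRep μ R (crossedCone μ R) (iA μ R) (iG μ R) where
  isContCovRep := isContCovRep_canonical μ R
  positive := isPositiveCovRep_canonical μ R
  nondegenerate := by
    obtain ⟨ι, _, _, _, e, M, -, hM, he⟩ := hleft
    exact fun x => mem_closure_of_tendsto (tendsto_iA μ R hM he x)
      (Eventually.of_forall fun i => Submodule.subset_span ⟨_, _, rfl⟩)
  isRContinuous := ⟨1, fun f => ContinuousLinearMap.opNorm_le_bound _
    (by simpa using sigma_nonneg μ R f) fun x => by
      rw [integrated_canonical, one_mul, ← norm_q]
      exact norm_mul_le _ _⟩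

/-! ### Approximate identities of the crossed product -/

/-- For `f` in `C_c(G, A₊)`, left multiplication by `q f` is an integrated form of the positive
canonical pair, hence a positive operator; a closure argument in the left factor does the rest. -/
theorem isAlgebraCone_crossedCone : IsAlgebraCone (crossedCone μ R) := by
  intro x hx y hy
  refine crossedCone_subset_of_isClosed μ R (P := {x | x * y ∈ crossedCone μ R})
    ((isClosed_crossedCone μ R).preimage (continuous_mul_const y)) (fun f hf => ?_) hx
  have := (isContCovRep_canonical μ R).integrated_mem_positiveOperators μ
    (isClosed_crossedCone μ R) (isPositiveCovRep_canonical μ R) hf y hy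
  rwa [integrated_canonical] at this

/-- Left multiplication by `q (tensor z (e i))` is an integrated form, close to `i_A(e i)` on
vectors that `i_G` barely moves on the support of `z`, and `i_A(e i)` tends strongly to the
identity. -/
theorem hasPosBddApproxLeftIdentity_crossedCone (hleft : HasPosBddApproxLeftIdentity D.cone) :
    HasPosBddApproxLeftIdentity (crossedCone μ R) := by
  obtain ⟨ι, _, _, _, e, M, hpos, hM, he⟩ := hleft
  obtain ⟨K, hK, hK1⟩ := exists_compact_mem_nhds (1 : G)
  obtain ⟨C, hC, hCK⟩ := exists_norm_q_tensor_le μ R hK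
  obtain ⟨C', hC', hiA⟩ := exists_norm_iA_le μ R
  refine exists_net_of_finite_approx (C := (crossedCone μ R : Set (CrossedProduct μ R)))
    (S := Set.univ) (Φ := ContinuousLinearMap.mul ℝ (CrossedProduct μ R))
    (ContinuousLinearMap.opNorm_mul_apply_le ℝ _) dense_univ (M := C * M) fun F _ ε hε => ?_
  have hM0 : 0 ≤ M := (norm_nonneg _).trans (hM (Classical.arbitrary ι))
  -- As `C' * M` bounds every `‖iA μ R (e i)‖`, the density `z` can be fixed before `i`.
  have hV : ∀ᶠ r in 𝓝 (1 : G), ∀ x ∈ F, ‖iG μ R r x - x‖ < ε / 2 / (C' * M + 1) := by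
    refine (eventually_all_finset F).2 fun x _ => ?_
    exact ((continuous_iG μ R x).sub continuous_const).norm.continuousAt.eventually_lt
      continuousAt_const (by simpa using by positivity)
  obtain ⟨z, hz⟩ := exists_isBump μ (inter_mem hK1 hV)
  have hE : ∀ᶠ i in atTop, ∀ x ∈ F, ‖iA μ R (e i) x - x‖ < ε / 2 := by
    refine (eventually_all_finset F).2 fun x _ => ?_
    simpa only [dist_eq_norm] using
      Metric.tendsto_nhds.1 (tendsto_iA μ R hM he x) (ε / 2) (by positivity)
  obtain ⟨i, hi⟩ := hE.exists
  refine ⟨q μ R (tensor z (e i)), q_mem_crossedCone μ R (hz.tensor_mem_ccCone (hpos i)),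
    (hCK z _ (hz.mono Set.inter_subset_left)).trans (mul_le_mul_of_nonneg_left (hM i) hC),
    fun x hx => ?_⟩
  have h1 := (isContCovRep_canonical μ R).norm_integrated_tensor_sub_le hz (e i) (x := x)
    (fun r hr => (hr.2 x hx).le)
  rw [integrated_canonical] at h1
  have h2 : ‖iA μ R (e i)‖ * (ε / 2 / (C' * M + 1)) ≤ ε / 2 := by
    have h3 : ‖iA μ R (e i)‖ ≤ C' * M := (hiA _).trans (mul_le_mul_of_nonneg_left (hM i) hC')
    rw [← mul_div_assoc, div_le_iff₀ (by positivity)]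
    nlinarith
  calc ‖q μ R (tensor z (e i)) * x - x‖
      ≤ ‖q μ R (tensor z (e i)) * x - iA μ R (e i) x‖ + ‖iA μ R (e i) x - x‖ :=
        norm_sub_le_norm_sub_add_norm_sub _ _ _
    _ < ε / 2 + ε / 2 := add_lt_add_of_le_of_lt (h1.trans h2) (hi x hx)
    _ = ε := add_halves ε

/-- Right multiplication is not an integrated form of the canonical pair, so the approximation is
made by the explicit convolution estimate, on the dense range of `q` only. -/
theorem hasPosBddApproxRightIdentity_crossedCone (hright : HasPosBddApproxRightIdentity D.cone) :
    HasPosBddApproxRightIdentity (crossedCone μ R) := by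
  obtain ⟨ι, _, _, _, e, M, hpos, hM, he⟩ := hright
  obtain ⟨K, hK, hK1⟩ := exists_compact_mem_nhds (1 : G)
  obtain ⟨C, hC, hCK⟩ := exists_norm_q_tensor_le μ R hK
  refine exists_net_of_finite_approx (C := (crossedCone μ R : Set (CrossedProduct μ R)))
    (S := Set.range (q μ R)) (Φ := (ContinuousLinearMap.mul ℝ (CrossedProduct μ R)).flip)
    (fun x => ContinuousLinearMap.opNorm_le_bound _ (norm_nonneg _) fun y => by
      simpa [mul_comm] using norm_mul_le y x)
    (denseRange_q μ R) (M := C * M) fun F hF ε hε => ?_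
  have h : ∀ x ∈ F, ∃ V ∈ 𝓝 (1 : G), ∀ᶠ i in atTop, ∀ z, IsBump μ z V →
      ‖x * q μ R (tensor z (e i)) - x‖ < ε := by
    intro x hx
    obtain ⟨f, rfl⟩ := hF hx
    exact eventually_norm_q_mul_tensor_sub_lt μ R hM he f hε
  choose! V hV hVe using h
  obtain ⟨z, hz⟩ := exists_isBump μ (inter_mem hK1 ((biInter_finset_mem F).2 hV))
  obtain ⟨i, hi⟩ := ((eventually_all_finset F).2 hVe).exists
  exact ⟨q μ R (tensor z (e i)), q_mem_crossedCone μ R (hz.tensor_mem_ccCone (hpos i)),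
    (hCK z _ (hz.mono Set.inter_subset_left)).trans (mul_le_mul_of_nonneg_left (hM i) hC),
    fun x hx => hi x hx z (hz.mono (Set.inter_subset_right.trans (Set.biInter_subset_of_mem hx)))⟩

end OrderedCrossedProduct

namespace OrderedCrossedProduct

/-! ### Left centralizers -/

section centralizers

variable {E : Type u} [NonUnitalNormedRing E] [NormedSpace ℝ E]
  [IsScalarTower ℝ E E] [SMulCommClass ℝ E E]

theorem coe_leftRegular (b : E) :
    (leftRegular b : E →L[ℝ] E) = ContinuousLinearMap.mul ℝ E b := rfl

theorem mul_leftRegular (L : leftCentralizers E) (b : E) :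
    L * leftRegular b = leftRegular ((L : E →L[ℝ] E) b) :=
  Subtype.ext (ContinuousLinearMap.ext fun c => L.2 b c)

theorem isEmbedding_leftRegular_iff :
    IsEmbedding (leftRegular : E → leftCentralizers E) ↔
      ∃ C : ℝ, ∀ b : E, ‖b‖ ≤ C * ‖ContinuousLinearMap.mul ℝ E b‖ := by
  have hcomp : (Subtype.val ∘ leftRegular : E → E →L[ℝ] E) = ContinuousLinearMap.mul ℝ E := rfl
  rw [← IsEmbedding.subtypeVal.of_comp_iff, hcomp]
  constructor
  · intro h
    obtain ⟨K, hK⟩ := (ContinuousLinearMap.mul ℝ E).antilipschitz_of_isEmbedding h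
    exact ⟨K, fun b => by simpa using hK.le_mul_dist b 0⟩
  · rintro ⟨C, hC⟩
    have : AntilipschitzWith C.toNNReal (ContinuousLinearMap.mul ℝ E) :=
      AddMonoidHomClass.antilipschitz_of_bound _ fun b => (hC b).trans
        (mul_le_mul_of_nonneg_right (Real.le_coe_toNNReal C) (norm_nonneg _))
    exact (this.isUniformEmbedding
      (ContinuousLinearMap.mul ℝ E).uniformContinuous).isEmbedding

/-- Pass to the limit in `‖b * e i‖ ≤ ‖λ(b)‖ M`. -/
theorem HasPosBddApproxRightIdentity.exists_norm_le {C : PointedCone ℝ E}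
    (h : HasPosBddApproxRightIdentity C) :
    ∃ M : ℝ, ∀ b : E, ‖b‖ ≤ M * ‖ContinuousLinearMap.mul ℝ E b‖ := by
  obtain ⟨ι, _, _, _, e, M, -, hM, he⟩ := h
  refine ⟨M, fun b => le_of_tendsto (he b).norm (Eventually.of_forall fun i => ?_)⟩
  rw [mul_comm]
  exact (ContinuousLinearMap.mul ℝ E b).le_opNorm_of_le (hM i)

/-- If `λ(b)` is positive, then `b` is the limit of the elements `b * e i` of the closed cone. -/
theorem HasPosBddApproxRightIdentity.leftRegular_mem_positiveCentralizers_iff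
    {C : PointedCone ℝ E} (h : HasPosBddApproxRightIdentity C) (hC : IsClosed (C : Set E))
    (hmul : IsAlgebraCone C) (b : E) : leftRegular b ∈ positiveCentralizers C ↔ b ∈ C := by
  obtain ⟨ι, _, _, _, e, M, hpos, -, he⟩ := h
  exact ⟨fun hb => hC.mem_of_tendsto (he b) (Eventually.of_forall fun i => hb _ (hpos i)),
    fun hb x hx => hmul b hb x hx⟩

/-- A positive non-degenerate bounded representation of `E` extends to the left centralizers. -/
theorem HasPosBddApproxLeftIdentity.exists_centralizer_extension {CE : PointedCone ℝ E}
    (hE : HasPosBddApproxLeftIdentity CE) {X : Type u} [NormedAddCommGroup X] [NormedSpace ℝ X]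
    [CompleteSpace X] {CX : PointedCone ℝ X} (hCX : IsClosed (CX : Set X))
    {T : E →ₙₐ[ℝ] (X →L[ℝ] X)} (hT : IsPosNondegBddRep (CE : Set E) CX T) :
    ∃ Tbar : leftCentralizers E →ₙₐ[ℝ] (X →L[ℝ] X),
      IsPosNondegBddRep (positiveCentralizers CE) CX Tbar ∧
      (∀ b, Tbar (leftRegular b) = T b) ∧
      ∀ (L : leftCentralizers E) b, Tbar L * T b = T ((L : E →L[ℝ] E) b) := by
  obtain ⟨ι, _, _, _, e, M, hpos, hM, he⟩ := hE
  obtain ⟨N, hN⟩ := hT.bounded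
  have hcont : Continuous T := AddMonoidHomClass.continuous_of_bound T N hN
  have hM0 : 0 ≤ M := (norm_nonneg _).trans (hM (Classical.arbitrary ι))
  -- `S` is the strong limit of `T (L e_i)`: on vectors `T b x` one has `T (L e_i) T b x = T (L (e_i
  -- b)) x`, which tends to `T (L b) x`.
  have hex : ∀ L : leftCentralizers E, ∃ S : X →L[ℝ] X, ‖S‖ ≤ max N 0 * M * ‖L‖ ∧
      (∀ b, S * T b = T ((L : E →L[ℝ] E) b)) ∧
      (L ∈ positiveCentralizers CE → S ∈ positiveOperators CX) := by
    intro L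
    have hlim : ∀ b x, Tendsto (fun i => T ((L : E →L[ℝ] E) (e i)) (T b x)) atTop
        (𝓝 (T ((L : E →L[ℝ] E) b) x)) := by
      intro b x
      have h1 : Continuous fun c => T ((L : E →L[ℝ] E) c) x :=
        (hcont.comp (L : E →L[ℝ] E).continuous).clm_apply continuous_const
      refine ((h1.tendsto b).comp (he b)).congr fun i => ?_
      simp only [Function.comp_apply]
      rw [L.2, map_mul]
      rfl
    obtain ⟨S, hS, hSlim⟩ := exists_limit_operator (l := atTop)
      (F := fun i => T ((L : E →L[ℝ] E) (e i))) (M := max N 0 * M * ‖L‖) (by positivity)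
      (fun i => by
        refine (hN _).trans ?_
        have h1 : ‖(L : E →L[ℝ] E) (e i)‖ ≤ ‖L‖ * M :=
          (L : E →L[ℝ] E).le_opNorm_of_le (hM i)
        calc N * ‖(L : E →L[ℝ] E) (e i)‖ ≤ max N 0 * (‖L‖ * M) := by
              gcongr
              exact le_max_left _ _
          _ = max N 0 * M * ‖L‖ := by ring)
      hT.nondegenerate (by rintro _ ⟨b, x, rfl⟩; exact ⟨_, hlim b x⟩)
    refine ⟨S, hS, fun b => ContinuousLinearMap.ext fun x =>
      tendsto_nhds_unique (hSlim (T b x)) (hlim b x), fun hL x hx => ?_⟩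
    exact hCX.mem_of_tendsto (hSlim x)
      (Eventually.of_forall fun i => hT.positive _ (hL _ (hpos i)) x hx)
  choose S hS hST hSpos using hex
  -- The relation `S * T b = T (L b)` thus determines `S`, and every algebraic law of `Tbar` follows
  -- from it.
  have huniq : ∀ S₁ S₂ : X →L[ℝ] X, (∀ b, S₁ * T b = S₂ * T b) → S₁ = S₂ := by
    intro S₁ S₂ h
    refine ContinuousLinearMap.ext_on hT.nondegenerate ?_
    rintro _ ⟨b, x, rfl⟩
    exact DFunLike.congr_fun (h b) x
  let Tbar : leftCentralizers E →ₙₐ[ℝ] (X →L[ℝ] X) :=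
    { toFun := S
      map_smul' := fun c L => huniq _ _ fun b => by
        rw [hST, MonoidHom.id_apply, smul_mul_assoc, hST, ← map_smul]
        rfl
      map_zero' := huniq _ _ fun b => by
        rw [hST, zero_mul]
        exact map_zero T
      map_add' := fun L L' => huniq _ _ fun b => by
        rw [hST, add_mul, hST, hST, ← map_add]
        rfl
      map_mul' := fun L L' => huniq _ _ fun b => by
        rw [hST, mul_assoc, hST, hST]
        rfl }
  have hTbar : ∀ b, Tbar (leftRegular b) = T b := fun b => huniq _ _ fun c => by
    rw [← map_mul]
    exact hST _ c
  refine ⟨Tbar, ⟨hSpos, ?_, _, hS⟩, hTbar, hST⟩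
  refine hT.nondegenerate.mono (Submodule.span_mono ?_)
  rintro _ ⟨b, x, rfl⟩
  exact ⟨leftRegular b, x, by rw [hTbar]⟩

end centralizers

/-! ### The crossed product is a generating triple -/

variable {A G : Type u} [NonUnitalNormedRing A] [NormedSpace ℝ A]
  [Group G] [TopologicalSpace G]
  [IsScalarTower ℝ A A] [SMulCommClass ℝ A A] [CompleteSpace A] [IsTopologicalGroup G]
  [LocallyCompactSpace G] [T2Space G] [MeasurableSpace G] [BorelSpace G]
  {D : DynSystem A G} (μ : Measure G) [μ.IsHaarMeasure] (R : UniformlyBoundedClass D)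

theorem integrated_canonical_eq_leftRegular (f : C_c(G, A)) :
    (isContCovRep_canonical μ R).integrated μ f
      = (leftRegular (q μ R f) : CrossedProduct μ R →L[ℝ] CrossedProduct μ R) :=
  ContinuousLinearMap.ext fun x => integrated_canonical μ R f x

/-- `T` extends the integrated form of `(π, U)`. Both `Tbar (i_A a)` and `π a` send `T b x` to `T
(i_A(a) b) x`, and these vectors span a dense subspace; the same argument works for `i_G`. -/
theorem exists_rep_of_isPosNondegRContRep (hleft : HasPosBddApproxLeftIdentity D.cone)
    {X : Type u} [NormedAddCommGroup X] [NormedSpace ℝ X] [CompleteSpace X]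
    {CX : PointedCone ℝ X} (hCX : IsClosed (CX : Set X))
    {π : A →ₙₐ[ℝ] (X →L[ℝ] X)} {U : G →* (X →L[ℝ] X)} (h : IsPosNondegRContRep μ R CX π U) :
    ∃ (T : CrossedProduct μ R →ₙₐ[ℝ] (X →L[ℝ] X))
      (Tbar : leftCentralizers (CrossedProduct μ R) →ₙₐ[ℝ] (X →L[ℝ] X)),
      IsPosNondegBddRep (crossedCone μ R : Set (CrossedProduct μ R)) CX T ∧
      IsPosNondegBddRep (positiveCentralizers (crossedCone μ R)) CX Tbar ∧
      (∀ b, Tbar (leftRegular b) = T b) ∧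
      (∀ a, Tbar ⟨iA μ R a, iA_mem_leftCentralizers μ R a⟩ = π a) ∧
      (∀ s, Tbar ⟨iG μ R s, iG_mem_leftCentralizers μ R s⟩ = U s) := by
  have hc := h.isContCovRep
  obtain ⟨T₀, hT₀⟩ := hc.exists_extension μ R h.isRContinuous
  let T : CrossedProduct μ R →ₙₐ[ℝ] (X →L[ℝ] X) :=
    { toFun := T₀
      map_smul' := fun c x => map_smul T₀ c x
      map_zero' := map_zero T₀
      map_add' := map_add T₀
      map_mul' := hc.extension_mul hT₀ }
  have hTd : Dense (Submodule.span ℝ {y : X | ∃ b x, y = T b x} : Set X) := by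
    refine (hc.dense_span_integrated μ h.nondegenerate).mono (Submodule.span_mono ?_)
    rintro _ ⟨f, x, rfl⟩
    exact ⟨q μ R f, x, DFunLike.congr_fun (hT₀ f).symm x⟩
  have hT : IsPosNondegBddRep (crossedCone μ R : Set (CrossedProduct μ R)) CX T :=
    ⟨fun b hb => hc.extension_mem_positiveOperators hT₀ hCX h.positive hb, hTd,
      ‖T₀‖, T₀.le_opNorm⟩
  obtain ⟨Tbar, h1, h2, h3⟩ := (hasPosBddApproxLeftIdentity_crossedCone μ R
    hleft).exists_centralizer_extension hCX hT
  refine ⟨T, Tbar, hT, h1, h2, fun a => ContinuousLinearMap.ext_on hTd ?_,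
    fun s => ContinuousLinearMap.ext_on hTd ?_⟩
  · rintro _ ⟨b, x, rfl⟩
    exact DFunLike.congr_fun
      ((h3 ⟨_, iA_mem_leftCentralizers μ R a⟩ b).trans (hc.extension_iA hT₀ a b)) x
  · rintro _ ⟨b, x, rfl⟩
    exact DFunLike.congr_fun
      ((h3 ⟨_, iG_mem_leftCentralizers μ R s⟩ b).trans (hc.extension_iG hT₀ s b)) x

theorem isGeneratingTriple_crossedProduct (hleft : HasPosBddApproxLeftIdentity D.cone)
    (hright : HasPosBddApproxRightIdentity D.cone) :
    IsGeneratingTriple μ R (crossedCone μ R) (iA μ R) (iG μ R) := by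
  have hr := hasPosBddApproxRightIdentity_crossedCone μ R hright
  have hbi := hr.leftRegular_mem_positiveCentralizers_iff (isClosed_crossedCone μ R)
    (isAlgebraCone_crossedCone μ R)
  refine
    { isAlgebraCone := isAlgebraCone_crossedCone μ R
      isClosed_cone := isClosed_crossedCone μ R
      approxLeftIdentity := hasPosBddApproxLeftIdentity_crossedCone μ R hleft
      isEmbedding_leftRegular := isEmbedding_leftRegular_iff.2 hr.exists_norm_le
      bipositive_leftRegular := hbi
      rep := isPosNondegRContRep_canonical μ R hleft
      kA_mem := iA_mem_leftCentralizers μ R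
      kG_mem := iG_mem_leftCentralizers μ R
      integrated_mem := fun f => ⟨q μ R f, integrated_canonical_eq_leftRegular μ R f⟩
      dense_integrated := ⟨?_, ?_⟩
      dense_integrated_cone := ⟨?_, ?_⟩
      generates := fun X _ _ _ CX hCX π U h => exists_rep_of_isPosNondegRContRep μ R hleft hCX h }
  · rintro _ ⟨f, rfl⟩
    exact ⟨q μ R f, (integrated_canonical_eq_leftRegular μ R f).symm⟩
  · rintro _ ⟨b, rfl⟩
    simp only [coe_leftRegular]
    refine map_mem_closure (ContinuousLinearMap.mul ℝ (CrossedProduct μ R)).continuous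
      (denseRange_q μ R b) ?_
    rintro _ ⟨f, rfl⟩
    exact ⟨f, integrated_canonical_eq_leftRegular μ R f⟩
  · rintro _ ⟨f, hf, rfl⟩
    refine ⟨⟨q μ R f, integrated_canonical_eq_leftRegular μ R f⟩, ?_, ?_⟩
    · simp only [integrated_canonical_eq_leftRegular]
      exact (leftRegular (q μ R f)).2
    · exact (isContCovRep_canonical μ R).integrated_mem_positiveOperators μ
        (isClosed_crossedCone μ R) (isPositiveCovRep_canonical μ R) hf
  · rintro _ ⟨⟨b, rfl⟩, -, hb⟩
    have hb' : b ∈ crossedCone μ R := (hbi b).1 hb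
    simp only [coe_leftRegular]
    refine map_mem_closure (ContinuousLinearMap.mul ℝ (CrossedProduct μ R)).continuous hb' ?_
    rintro _ ⟨f, hf, rfl⟩
    exact ⟨f, hf, integrated_canonical_eq_leftRegular μ R f⟩

end OrderedCrossedProduct

namespace OrderedCrossedProduct

/-! ### Uniqueness of the generating triple -/

section uniqueness

variable {A G : Type u} [NonUnitalNormedRing A] [NormedSpace ℝ A]
  [Group G] [TopologicalSpace G]
  [IsScalarTower ℝ A A] [SMulCommClass ℝ A A] [CompleteSpace A] [IsTopologicalGroup G]
  [LocallyCompactSpace G] [T2Space G] [MeasurableSpace G] [BorelSpace G]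
  {D : DynSystem A G} {μ : Measure G} [μ.IsHaarMeasure] {R : UniformlyBoundedClass D}
  {E : Type u} [NonUnitalNormedRing E] [NormedSpace ℝ E]
  [IsScalarTower ℝ E E] [SMulCommClass ℝ E E] [CompleteSpace E] {CE : PointedCone ℝ E}
  {kA : A →ₙₐ[ℝ] (E →L[ℝ] E)} {kG : G →* (E →L[ℝ] E)}

theorem IsGeneratingTriple.mul_injective (hE : IsGeneratingTriple μ R CE kA kG) :
    Function.Injective (ContinuousLinearMap.mul ℝ E) := fun _ _ h =>
  hE.isEmbedding_leftRegular.injective (Subtype.ext h)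

theorem IsGeneratingTriple.isEmbedding_mul (hE : IsGeneratingTriple μ R CE kA kG) :
    IsEmbedding (ContinuousLinearMap.mul ℝ E) :=
  IsEmbedding.subtypeVal.comp hE.isEmbedding_leftRegular

/-- The homomorphism from the crossed product that intertwines the integrated form of
`(k_A, k_G)` with the left regular representation. -/
theorem IsGeneratingTriple.exists_map (hE : IsGeneratingTriple μ R CE kA kG) :
    ∃ ψ : CrossedProduct μ R →L[ℝ] E, ∀ f,
      ContinuousLinearMap.mul ℝ E (ψ (q μ R f)) = hE.rep.isContCovRep.integrated μ f := by
  have hc := hE.rep.isContCovRep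
  obtain ⟨C, hC⟩ := isEmbedding_leftRegular_iff.1 hE.isEmbedding_leftRegular
  obtain ⟨M, hM⟩ := hE.rep.isRContinuous
  -- `b f` is the unique preimage of the integrated form under `λ`; uniqueness makes `b` linear, and
  -- its bound combines the embedding constant with the `R`-continuity constant.
  choose b hb using hE.integrated_mem
  replace hb : ∀ f, ContinuousLinearMap.mul ℝ E (b f) = hc.integrated μ f := fun f => (hb f).symm
  obtain ⟨ψ, hψ⟩ := exists_extension μ R b
    (fun f g => hE.mul_injective (by rw [map_add, hb, hb, hb, hc.integrated_add]))
    (fun c f => hE.mul_injective (by rw [map_smul, hb, hb, hc.integrated_smul]))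
    (M := max C 0 * M) (fun f => by
      refine (hC _).trans ?_
      rw [hb, mul_assoc]
      exact mul_le_mul (le_max_left _ _) (hM f) (norm_nonneg _) (le_max_right _ _))
  exact ⟨ψ, fun f => by rw [hψ, hb]⟩

variable {ψ : CrossedProduct μ R →L[ℝ] E}

theorem IsGeneratingTriple.map_crossed_mul (hE : IsGeneratingTriple μ R CE kA kG)
    (hψ : ∀ f, ContinuousLinearMap.mul ℝ E (ψ (q μ R f)) = hE.rep.isContCovRep.integrated μ f)
    (x y : CrossedProduct μ R) : ψ (x * y) = ψ x * ψ y := by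
  refine crossed_induction μ R (P := fun x => ψ (x * y) = ψ x * ψ y)
    (isClosed_eq (by fun_prop) (by fun_prop)) (fun f => ?_) x
  refine crossed_induction μ R (P := fun y => ψ (q μ R f * y) = ψ (q μ R f) * ψ y)
    (isClosed_eq (by fun_prop) (by fun_prop)) (fun g => hE.mul_injective ?_) y
  rw [← q_conv, hψ, hE.rep.isContCovRep.integrated_conv, ← hψ, ← hψ]
  ext c
  simp [mul_assoc]

/-- As `kA a` is a left centralizer, `λ(k_A(a) y) = k_A(a) λ(y)`; so both sides have the same image
under the injective `λ` when `x = q f`. -/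
theorem IsGeneratingTriple.map_iA (hE : IsGeneratingTriple μ R CE kA kG)
    (hψ : ∀ f, ContinuousLinearMap.mul ℝ E (ψ (q μ R f)) = hE.rep.isContCovRep.integrated μ f)
    (a : A) (x : CrossedProduct μ R) : kA a (ψ x) = ψ (iA μ R a x) := by
  refine crossed_induction μ R (P := fun x => kA a (ψ x) = ψ (iA μ R a x))
    (isClosed_eq (by fun_prop) (by fun_prop)) (fun f => hE.mul_injective ?_) x
  rw [iA_q, hψ, hE.rep.isContCovRep.integrated_iA₀ μ, ← hψ]
  exact ContinuousLinearMap.ext fun c => (hE.kA_mem a _ c).symm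

theorem IsGeneratingTriple.map_iG (hE : IsGeneratingTriple μ R CE kA kG)
    (hψ : ∀ f, ContinuousLinearMap.mul ℝ E (ψ (q μ R f)) = hE.rep.isContCovRep.integrated μ f)
    (s : G) (x : CrossedProduct μ R) : kG s (ψ x) = ψ (iG μ R s x) := by
  refine crossed_induction μ R (P := fun x => kG s (ψ x) = ψ (iG μ R s x))
    (isClosed_eq (by fun_prop) (by fun_prop)) (fun f => hE.mul_injective ?_) x
  rw [iG_q, hψ, hE.rep.isContCovRep.integrated_iG₀ μ, ← hψ]
  exact ContinuousLinearMap.ext fun c => (hE.kG_mem s _ c).symm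

/-- Every positive non-degenerate `R`-continuous covariant representation factors through `ψ`. -/
theorem IsGeneratingTriple.exists_factorization (hE : IsGeneratingTriple μ R CE kA kG)
    (hψ : ∀ f, ContinuousLinearMap.mul ℝ E (ψ (q μ R f)) = hE.rep.isContCovRep.integrated μ f)
    {X : Type u} [NormedAddCommGroup X] [NormedSpace ℝ X] [CompleteSpace X]
    {CX : PointedCone ℝ X} (hCX : IsClosed (CX : Set X))
    {π : A →ₙₐ[ℝ] (X →L[ℝ] X)} {U : G →* (X →L[ℝ] X)} (h : IsPosNondegRContRep μ R CX π U) :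
    ∃ T : E →L[ℝ] (X →L[ℝ] X), ∀ f, T (ψ (q μ R f)) = h.isContCovRep.integrated μ f := by
  have hc := hE.rep.isContCovRep
  obtain ⟨T₀, Tbar, hT, -, hbar, hA, hG⟩ := hE.generates X CX hCX π U h
  obtain ⟨N, hN⟩ := hT.bounded
  let T : E →L[ℝ] (X →L[ℝ] X) := (T₀ : E →ₗ[ℝ] (X →L[ℝ] X)).mkContinuous N hN
  have hTmul : ∀ b c, T (b * c) = T b * T c := map_mul T₀
  -- This is `Tbar` applied to `L λ(b) = λ(L b)`; it lets `T` carry `k_A` and `k_G` to `π` and `U`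
  -- under the integral below.
  have hL : ∀ (L : leftCentralizers E) b, T ((L : E →L[ℝ] E) b) = Tbar L * T b := by
    intro L b
    change T₀ _ = _ * T₀ b
    rw [← hbar, ← hbar, ← mul_leftRegular, map_mul]
  have hTA : ∀ a b, T (kA a b) = π a * T b := fun a b => by
    rw [← hA]; exact hL ⟨kA a, hE.kA_mem a⟩ b
  have hTG : ∀ s b, T (kG s b) = U s * T b := fun s b => by
    rw [← hG]; exact hL ⟨kG s, hE.kG_mem s⟩ b
  refine ⟨T, fun f => ContinuousLinearMap.ext_on hT.nondegenerate ?_⟩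
  rintro _ ⟨b, x, rfl⟩
  change (T (ψ (q μ R f)) * T b) x = h.isContCovRep.integrated μ f (T b x)
  have e : ψ (q μ R f) * b = ∫ r, kA (f r) (kG r b) ∂μ := by
    rw [← hc.integrated_apply μ, ← hψ, ContinuousLinearMap.mul_apply']
  have hi := hc.integrable μ f b
  rw [← hTmul, e, ← T.integral_comp_comm hi,
    ContinuousLinearMap.integral_apply (T.integrable_comp hi), IsContCovRep.integrated_apply]
  refine integral_congr_ae (Eventually.of_forall fun r => ?_)
  simp only
  rw [hTA, hTG]
  rfl

/-- The universal property of `E` is applied to the canonical pair on the crossed product. The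
resulting `T` satisfies `T (ψ x) = λ(x)`, and `λ` is bounded below there by the right approximate
identity. -/
theorem IsGeneratingTriple.exists_norm_le (hleft : HasPosBddApproxLeftIdentity D.cone)
    (hright : HasPosBddApproxRightIdentity D.cone) (hE : IsGeneratingTriple μ R CE kA kG)
    (hψ : ∀ f, ContinuousLinearMap.mul ℝ E (ψ (q μ R f)) = hE.rep.isContCovRep.integrated μ f) :
    ∃ C : ℝ, ∀ x, ‖x‖ ≤ C * ‖ψ x‖ := by
  obtain ⟨T, hT⟩ := hE.exists_factorization hψ (isClosed_crossedCone μ R)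
    (isPosNondegRContRep_canonical μ R hleft)
  obtain ⟨M, hM⟩ := (hasPosBddApproxRightIdentity_crossedCone μ R hright).exists_norm_le
  have hTx : ∀ x, T (ψ x) = ContinuousLinearMap.mul ℝ (CrossedProduct μ R) x :=
    crossed_induction μ R (isClosed_eq (by fun_prop) (by fun_prop)) fun f => by
      rw [hT]
      exact integrated_canonical_eq_leftRegular μ R f
  refine ⟨max M 0 * ‖T‖, fun x => (hM x).trans ?_⟩
  rw [← hTx, mul_assoc]
  exact mul_le_mul (le_max_left _ _) (T.le_opNorm _) (norm_nonneg _) (le_max_right _ _)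

theorem IsGeneratingTriple.dense_range_map (hE : IsGeneratingTriple μ R CE kA kG)
    (hψ : ∀ f, ContinuousLinearMap.mul ℝ E (ψ (q μ R f)) = hE.rep.isContCovRep.integrated μ f) :
    DenseRange ψ := by
  intro y
  have h := hE.dense_integrated.2 ⟨y, rfl⟩
  rw [hE.isEmbedding_mul.isInducing.closure_eq_preimage_closure_image]
  refine closure_mono ?_ h
  rintro _ ⟨f, rfl⟩
  exact ⟨_, ⟨q μ R f, rfl⟩, hψ f⟩

/-- Being bounded below, `ψ` is injective with closed range; that range is also dense, so `ψ` is
bijective and the open mapping theorem applies. -/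
theorem IsGeneratingTriple.exists_equiv (hleft : HasPosBddApproxLeftIdentity D.cone)
    (hright : HasPosBddApproxRightIdentity D.cone) (hE : IsGeneratingTriple μ R CE kA kG) :
    ∃ ψ : CrossedProduct μ R ≃L[ℝ] E, ∀ f,
      ContinuousLinearMap.mul ℝ E (ψ (q μ R f)) = hE.rep.isContCovRep.integrated μ f := by
  obtain ⟨ψ, hψ⟩ := hE.exists_map
  obtain ⟨C, hC⟩ := hE.exists_norm_le hleft hright hψ
  have hanti : AntilipschitzWith C.toNNReal ψ :=
    AddMonoidHomClass.antilipschitz_of_bound _ fun b => (hC b).trans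
      (mul_le_mul_of_nonneg_right (Real.le_coe_toNNReal C) (norm_nonneg _))
  have hsurj : Function.Surjective ψ := by
    rw [← Set.range_eq_univ, ← (hanti.isClosed_range ψ.uniformContinuous).closure_eq]
    exact (hE.dense_range_map hψ).closure_eq
  exact ⟨ContinuousLinearEquiv.ofBijective ψ (LinearMap.ker_eq_bot.2 hanti.injective)
    (LinearMap.range_eq_top.2 hsurj), hψ⟩

/-- Condition 4 places `λ(ψ x)` in the closure of the integrated forms of `C_c(G, A₊)`, and the
embedding `λ ∘ ψ` pulls this closure back into the crossed cone. Conversely, these integrated forms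
are positive and `λ` is bipositive, so `ψ` maps the generators of the crossed cone into the closed
cone `CE`. -/
theorem IsGeneratingTriple.mem_cone_iff (hE : IsGeneratingTriple μ R CE kA kG)
    {ψ : CrossedProduct μ R ≃L[ℝ] E}
    (hψ : ∀ f, ContinuousLinearMap.mul ℝ E (ψ (q μ R f)) = hE.rep.isContCovRep.integrated μ f)
    (x : CrossedProduct μ R) : ψ x ∈ CE ↔ x ∈ crossedCone μ R := by
  constructor
  · intro hx
    have h : ContinuousLinearMap.mul ℝ E (ψ x) ∈ closure
        ((fun f => hE.rep.isContCovRep.integrated μ f) '' (ccCone D : Set C_c(G, A))) :=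
      hE.dense_integrated_cone.2 ⟨⟨ψ x, rfl⟩, (leftRegular (ψ x)).2,
        (hE.bipositive_leftRegular _).2 hx⟩
    have hind := hE.isEmbedding_mul.isInducing.comp ψ.toHomeomorph.isInducing
    have h2 : x ∈ closure (q μ R '' (ccCone D : Set C_c(G, A))) := by
      rw [hind.closure_eq_preimage_closure_image]
      refine closure_mono ?_ h
      rintro _ ⟨f, hf, rfl⟩
      exact ⟨_, ⟨f, hf, rfl⟩, hψ f⟩
    refine closure_minimal ?_ (isClosed_crossedCone μ R) h2
    rintro _ ⟨f, hf, rfl⟩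
    exact q_mem_crossedCone μ R hf
  · intro hx
    refine crossedCone_subset_of_isClosed μ R (hE.isClosed_cone.preimage ψ.continuous)
      (fun f hf => (hE.bipositive_leftRegular _).1 ?_) hx
    change ContinuousLinearMap.mul ℝ E (ψ (q μ R f)) ∈ positiveOperators CE
    rw [hψ]
    exact hE.rep.isContCovRep.integrated_mem_positiveOperators μ hE.isClosed_cone
      hE.rep.positive hf

/-- Conjugation by `ψ` carries the integrated form of the canonical pair, which is left
multiplication by `q f`, to that of `(k_A, k_G)`. This fixes `λ(ψ (q f))` and hence `ψ`. -/
theorem IsInducingIso.mul_map_q (hE : IsGeneratingTriple μ R CE kA kG)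
    {ψ : CrossedProduct μ R ≃L[ℝ] E} (hψ : IsInducingIso μ R kA kG ψ) (f : C_c(G, A)) :
    ContinuousLinearMap.mul ℝ E (ψ (q μ R f)) = hE.rep.isContCovRep.integrated μ f := by
  ext z
  have hi := (isContCovRep_canonical μ R).integrable μ f (ψ.symm z)
  have h1 : ψ (q μ R f) * z = ψ (q μ R f * ψ.symm z) := by
    rw [hψ.map_mul, ψ.apply_symm_apply]
  rw [ContinuousLinearMap.mul_apply', h1, ← integrated_canonical, IsContCovRep.integrated_apply,
    IsContCovRep.integrated_apply]
  refine ((ψ : CrossedProduct μ R →L[ℝ] E).integral_comp_comm hi).symm.trans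
    (integral_congr_ae (Eventually.of_forall fun r => ?_))
  simp only
  rw [hψ.induces_kA, hψ.induces_kG, ψ.symm_apply_apply]
  rfl

theorem HasPosBddApproxRightIdentity.map {F : Type u} [NonUnitalNormedRing F] [NormedSpace ℝ F]
    {CF : PointedCone ℝ F} (h : HasPosBddApproxRightIdentity CF) (ψ : F ≃L[ℝ] E)
    (hmul : ∀ x y, ψ (x * y) = ψ x * ψ y) (hpos : ∀ x ∈ CF, ψ x ∈ CE) :
    HasPosBddApproxRightIdentity CE := by
  obtain ⟨ι, i₁, i₂, i₃, e, M, he, hM, hlim⟩ := h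
  refine ⟨ι, i₁, i₂, i₃, fun i => ψ (e i), ‖(ψ : F →L[ℝ] E)‖ * M, fun i => hpos _ (he i),
    fun i => (ψ : F →L[ℝ] E).le_opNorm_of_le (hM i), fun a => ?_⟩
  have := (ψ.continuous.tendsto _).comp (hlim (ψ.symm a))
  simpa [Function.comp_def, hmul] using this

end uniqueness

end OrderedCrossedProduct

/-! ### The main theorem -/

open OrderedCrossedProduct in
theorem corollary4p8 {A G : Type u}
    [NonUnitalNormedRing A] [NormedSpace ℝ A] [IsScalarTower ℝ A A] [SMulCommClass ℝ A A]
    [CompleteSpace A]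
    [Group G] [TopologicalSpace G] [IsTopologicalGroup G] [LocallyCompactSpace G] [T2Space G]
    [MeasurableSpace G] [BorelSpace G] (μ : Measure G) [μ.IsHaarMeasure]
    (D : DynSystem A G)
    (hleft : HasPosBddApproxLeftIdentity D.cone)
    (hright : HasPosBddApproxRightIdentity D.cone)
    (R : UniformlyBoundedClass D)
    (hpos : ∀ ρ ∈ R.carrier, IsPositiveCovRep D ρ.cone ρ.π ρ.U)
    (hnondeg : ∀ ρ ∈ R.carrier, IsNondegenerate ρ.π) :
    IsGeneratingTriple μ R (crossedCone μ R) (iA μ R) (iG μ R) ∧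
    ∀ (E : Type u) [NonUnitalNormedRing E] [NormedSpace ℝ E]
      [IsScalarTower ℝ E E] [SMulCommClass ℝ E E] [CompleteSpace E] (CE : PointedCone ℝ E)
      (kA : A →ₙₐ[ℝ] (E →L[ℝ] E)) (kG : G →* (E →L[ℝ] E)),
      IsGeneratingTriple μ R CE kA kG →
      (∃ ψ : CrossedProduct μ R ≃L[ℝ] E,
        IsInducingIso μ R kA kG ψ ∧
        (∀ ψ' : CrossedProduct μ R ≃L[ℝ] E, IsInducingIso μ R kA kG ψ' → ψ' = ψ) ∧
        ∀ x, ψ x ∈ CE ↔ x ∈ crossedCone μ R) ∧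
      HasPosBddApproxRightIdentity CE := by
  refine ⟨isGeneratingTriple_crossedProduct μ R hleft hright, ?_⟩
  intro E _ _ _ _ _ CE kA kG hE
  obtain ⟨ψ, hψ⟩ := hE.exists_equiv hleft hright
  have hmul := hE.map_crossed_mul (ψ := (ψ : CrossedProduct μ R →L[ℝ] E)) hψ
  have hcone := hE.mem_cone_iff hψ
  refine ⟨⟨ψ, ⟨hmul, fun a z => ?_, fun s z => ?_⟩, fun ψ' hψ' => ?_, hcone⟩,
    (hasPosBddApproxRightIdentity_crossedCone μ R hright).map ψ hmul fun x => (hcone x).2⟩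
  · simpa using hE.map_iA (ψ := (ψ : CrossedProduct μ R →L[ℝ] E)) hψ a (ψ.symm z)
  · simpa using hE.map_iG (ψ := (ψ : CrossedProduct μ R →L[ℝ] E)) hψ s (ψ.symm z)
  · refine ContinuousLinearEquiv.ext (funext ?_)
    exact crossed_induction μ R (isClosed_eq ψ'.continuous ψ.continuous) fun f =>
      hE.mul_injective ((hψ'.mul_map_q hE f).trans (hψ f).symm)
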